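/- All graphs are finite, simple and undirected. A graph $G$ is \emph{$3$-connected} if $|V(G)|>3$ and $G-T$ is connected for every $T\subseteq V(G)$ with $|T|<3$; it is \emph{cubic} if every vertex has degree $3$. An edge $e$ of a $3$-connected graph $G$ is \emph{$3$-contractible} if the graph $G/e$ obtained by identifying the two endvertices of $e$ and simplifying the result is $3$-connected. A \emph{DFS tree} of $G$ is a spanning tree $Q$ with a prescribed root $r$ such that for every vertex $x$ no edge of $G$ joins two distinct components of $Q-x$ that do not contain $r$. For a cubic graph $G$, let its \emph{triangle replacement} $G'$ be the graph obtained by replacing every vertex $x$ with a triangle $\Delta_x$ such that, for each of the three edges $e$ at $x$, the endvertex $x$ of $e$ is replaced with its own vertex of $\Delta_x$. For a subgraph $T$ of $G$, a \emph{lift} of $T$ is a subgraph $T'$ of $G'$ formed by all edges of $T$ together with the edges of one spanning path of each triangle $\Delta_x$. Theorem. (i) Let $G$ be a cubic $3$-connected graph nonisomorphic to $K_4$. Then every spanning tree of $G$ contains at least $\frac13|V(G)|-1$ edges that are $3$-contractible in $G$. (ii) The bound is sharp, also when restricted to DFS trees: there are arbitrarily large cubic $3$-connected graphs $G$ nonisomorphic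 to $K_4$ that have a DFS tree containing exactly $\frac13|V(G)|-1$ edges that are $3$-contractible in $G$. (iii) More precisely, let $G$ be any cubic $3$-connected graph, and let $G'$ be its triangle replacement. Then $G'$ is cubic, $3$-connected and nonisomorphic to $K_4$. Every spanning tree $T$ of $G$ has a lift, and every lift of $T$ is a spanning tree of $G'$ that contains exactly $\frac13|V(G')|-1$ edges that are $3$-contractible in $G'$. Moreover, for every Hamiltonian path $T$ of $G$ there is a lift $T'$ of $T$ that is a Hamiltonian path of $G'$; rooted at one of its ends, $T'$ is a DFS tree of $G'$, and it contains exactly $\frac13|V(G')|-1$ edges that are $3$-contractible in $G'$. -/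

import Mathlib

namespace SimpleGraph

/-- `G` is `k`-connected: it has more than `k` vertices, and deleting fewer than `k` vertices
always leaves a connected graph. -/
def IsKConnected {V : Type*} (G : SimpleGraph V) (k : ℕ) : Prop :=
  k < Nat.card V ∧ ∀ T : Finset V, T.card < k → (G.induce {v | v ∉ T}).Connected

/-- Every vertex has exactly three neighbours. -/
def IsCubic {V : Type*} (G : SimpleGraph V) : Prop :=
  ∀ v, (G.neighborSet v).ncard = 3

/-- The equivalence relation on vertices that identifies the two ends of `e` and nothing else. -/
def contractSetoid {V : Type*} (e : Sym2 V) : Setoid V where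
  r u v := u = v ∨ (u ∈ e ∧ v ∈ e)
  iseqv :=
    { refl := fun _ => Or.inl rfl
      symm := by
        rintro u v (h | ⟨h, h'⟩)
        · exact Or.inl h.symm
        · exact Or.inr ⟨h', h⟩
      trans := by
        rintro u v w (rfl | ⟨h, h'⟩) (rfl | ⟨k, k'⟩)
        · exact Or.inl rfl
        · exact Or.inr ⟨k, k'⟩
        · exact Or.inr ⟨h, h'⟩
        · exact Or.inr ⟨h, k'⟩ }

/-- The graph `G / e`: identify the ends of `e`, and simplify (no loops, no multiple edges). -/
def contractEdge {V : Type*} (G : SimpleGraph V) (e : Sym2 V) :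
    SimpleGraph (Quotient (contractSetoid e)) where
  Adj a b := a ≠ b ∧ ∃ u v : V,
    Quotient.mk (contractSetoid e) u = a ∧ Quotient.mk (contractSetoid e) v = b ∧ G.Adj u v
  symm := ⟨by
    rintro a b ⟨hab, u, v, hu, hv, h⟩
    exact ⟨hab.symm, v, u, hv, hu, h.symm⟩⟩
  loopless := ⟨fun _ h => h.1 rfl⟩

/-- The edge `e` of `G` is `k`-contractible (used for `k`-connected graphs `G`). -/
def IsKContractible {V : Type*} (G : SimpleGraph V) (k : ℕ) (e : Sym2 V) : Prop :=
  e ∈ G.edgeSet ∧ (G.contractEdge e).IsKConnected k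

/-- `Q` is a spanning tree of `G`. -/
def IsSpanningTree {V : Type*} (G Q : SimpleGraph V) : Prop :=
  Q ≤ G ∧ Q.IsTree

/-- `B` is an `x`-branch of the tree `Q` with root `r`: the vertex set of a component of `Q - x`
that does not contain `r`. -/
def IsBranch {V : Type*} (Q : SimpleGraph V) (r x : V) (B : Set V) : Prop :=
  (∃ C : (Q.induce {v | v ≠ x}).ConnectedComponent, B = Subtype.val '' C.supp) ∧ r ∉ B

/-- `Q` with root `r` is a DFS tree of `G`: a spanning tree such that, for every vertex `x`, any
two distinct `x`-branches are nonadjacent in `G`. -/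
def IsDFSTree {V : Type*} (G Q : SimpleGraph V) (r : V) : Prop :=
  G.IsSpanningTree Q ∧
    ∀ (x : V) (B B' : Set V), Q.IsBranch r x B → Q.IsBranch r x B' → B ≠ B' →
      ∀ u ∈ B, ∀ v ∈ B', ¬ G.Adj u v

/-- The number of edges of `Q` that are `k`-contractible edges of `G`. -/
noncomputable def numContractible {V : Type*} (G Q : SimpleGraph V) (k : ℕ) : ℕ :=
  {e | e ∈ Q.edgeSet ∧ G.IsKContractible k e}.ncard

/-- The triangle replacement of a cubic graph `G`. Its vertices are the pairs of a vertex `x` of `G`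
and an edge at `x`, i.e. the darts of `G`; the darts starting at `x` form the triangle replacing
`x`, and each edge of `G` joins its two darts. -/
def triangleReplacement {V : Type*} (G : SimpleGraph V) : SimpleGraph G.Dart where
  Adj d d' := (d ≠ d' ∧ d.fst = d'.fst) ∨ d' = d.symm
  symm := ⟨by
    rintro d d' (⟨h, h'⟩ | rfl)
    · exact Or.inl ⟨h.symm, h'.symm⟩
    · exact Or.inr (Dart.symm_symm d).symm⟩
  loopless := ⟨by
    rintro d (⟨h, -⟩ | h)
    · exact h rfl
    · exact Dart.symm_ne d h.symm⟩

/-- `T'` is formed by all edges of `T` (a subgraph of `G`) together with the edges of a spanning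
path of each triangle of the triangle replacement of `G`. -/
def IsTriangleLift {V : Type*} (G T : SimpleGraph V) (T' : SimpleGraph G.Dart) : Prop :=
  T' ≤ G.triangleReplacement ∧
  (∀ d : G.Dart, T'.Adj d d.symm ↔ T.Adj d.fst d.snd) ∧
  ∀ x : V, ∃ d₁ d₂ d₃ : G.Dart, d₁ ≠ d₃ ∧ {d : G.Dart | d.fst = x} = {d₁, d₂, d₃} ∧
    T'.Adj d₁ d₂ ∧ T'.Adj d₂ d₃ ∧ ¬ T'.Adj d₁ d₃

end SimpleGraph

namespace SimpleGraph

variable {V : Type*} {W : Type*}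

/-! Lower bound. The crucial fact is `adj_of_not_isKContractible`: two noncontractible edges that
share a vertex span a triangle. Two triangles sharing an edge form a diamond, whose two outer
vertices separate the inner two from everything else, so there is no diamond on more than four
vertices. Hence the noncontractible edges of a spanning tree contain neither a claw nor a path with
three edges: either would force a diamond or a triangle inside the tree. Their components are paths
with at most three vertices, so they number at most two thirds of |V|, and at least |V| - 1 - 2|V|/3
tree edges are contractible.

For the crucial fact, the ends of a noncontractible edge xy lie in a 3-separator {x, y, z}. As z has
degree 3, it sends at most one edge to one of two sides, and putting it on the other side splits V -
{x, y} into X and Y with at most one edge between them. Two such splittings, for xy and yw, cut the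
graph into y, x, w and four corners. If x and w are nonadjacent, 3-edge-connectivity and the degrees
of x, y, w contradict the two bounds by linear arithmetic (`false_of_crossing_separations`).

Sharpness. In a triangle replacement the edges of the triangles are noncontractible and the original
edges are contractible. A lift of a spanning tree T thus has exactly |E(T)| = |V| - 1 contractible
edges, while the new graph has 3|V| vertices. Hamiltonian paths lift to Hamiltonian paths, and a
Hamiltonian path rooted at an end is a DFS tree because no vertex has two branches. Iterating from
K_4 gives arbitrarily large examples. -/

/-! ### Connectedness through cuts -/

/-- The cut form reduces each later connectedness claim to exhibiting one crossing edge, with no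
walks involved. -/
theorem connected_iff_forall_cut (G : SimpleGraph V) :
    G.Connected ↔ Nonempty V ∧
      ∀ A : Set V, A.Nonempty → Aᶜ.Nonempty → ∃ u ∈ A, ∃ v, v ∉ A ∧ G.Adj u v := by
  constructor
  · rintro h
    refine ⟨h.nonempty, ?_⟩
    rintro A ⟨a, ha⟩ ⟨b, hb⟩
    obtain ⟨p⟩ := h.preconnected a b
    obtain ⟨d, -, h1, h2⟩ := p.exists_boundary_dart A ha hb
    exact ⟨d.fst, h1, d.snd, h2, d.adj⟩
  · rintro ⟨h1, h2⟩
    refine (connected_iff _).2 ⟨fun a b => ?_, h1⟩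
    by_contra hab
    obtain ⟨u, hu, v, hv, huv⟩ := h2 {x | G.Reachable a x} ⟨a, Reachable.refl _⟩ ⟨b, hab⟩
    exact hv (Reachable.trans hu huv.reachable)

theorem induce_connected_iff_forall_cut (G : SimpleGraph V) (s : Set V) :
    (G.induce s).Connected ↔ s.Nonempty ∧
      ∀ A ⊆ s, A.Nonempty → (s \ A).Nonempty → ∃ u ∈ A, ∃ v ∈ s \ A, G.Adj u v := by
  rw [connected_iff_forall_cut, Set.nonempty_coe_sort]
  refine and_congr_right fun _ => ⟨fun h A hA hA1 hA2 => ?_, fun h A hA1 hA2 => ?_⟩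
  · obtain ⟨a, ha⟩ := hA1
    obtain ⟨b, hb, hb'⟩ := hA2
    obtain ⟨u, hu, v, hv, huv⟩ := h (Subtype.val ⁻¹' A) ⟨⟨a, hA ha⟩, ha⟩ ⟨⟨b, hb⟩, hb'⟩
    exact ⟨u, hu, v, ⟨v.2, hv⟩, huv⟩
  · obtain ⟨a, ha⟩ := hA1
    obtain ⟨b, hb⟩ := hA2
    obtain ⟨u, ⟨u, hu, rfl⟩, v, ⟨hv, hv'⟩, huv⟩ := h (Subtype.val '' A) (by simp)
      ⟨a, a, ha, rfl⟩ ⟨b, b.2, by simpa using hb⟩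
    exact ⟨u, hu, ⟨v, hv⟩, fun h => hv' ⟨_, h, rfl⟩, huv⟩

/-- Connectedness passes to images under maps that may collapse edges. -/
theorem Connected.of_surjective_collapse {G : SimpleGraph V} {H : SimpleGraph W}
    (h : G.Connected) (f : V → W) (hf : Function.Surjective f)
    (hadj : ∀ x y, G.Adj x y → f x = f y ∨ H.Adj (f x) (f y)) : H.Connected := by
  rw [connected_iff_forall_cut] at h ⊢
  refine ⟨h.1.map f, ?_⟩
  rintro A ⟨a, ha⟩ ⟨b, hb⟩
  obtain ⟨a, rfl⟩ := hf a
  obtain ⟨b, rfl⟩ := hf b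
  obtain ⟨u, hu, v, hv, huv⟩ := h.2 (f ⁻¹' A) ⟨a, ha⟩ ⟨b, hb⟩
  refine ⟨f u, hu, f v, hv, (hadj _ _ huv).resolve_left fun h => hv ?_⟩
  rwa [Set.mem_preimage, ← h]

theorem IsKConnected.exists_adj {G : SimpleGraph V} {k : ℕ} (h : G.IsKConnected k)
    (T : Set V) (hT : T.Finite) (hTk : T.ncard < k) (A : Set V) (hA : Disjoint A T)
    (hA1 : A.Nonempty) (hA2 : (A ∪ T)ᶜ.Nonempty) :
    ∃ u ∈ A, ∃ v, v ∉ A ∧ v ∉ T ∧ G.Adj u v := by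
  have := h.2 hT.toFinset (by rwa [Set.ncard_eq_toFinset_card _ hT] at hTk)
  rw [induce_connected_iff_forall_cut] at this
  obtain ⟨b, hb⟩ := hA2
  obtain ⟨u, hu, v, ⟨hv, hv'⟩, huv⟩ := this.2 A
    (fun x hx => by simpa using Set.disjoint_left.1 hA hx) hA1
    ⟨b, by simp at hb ⊢; tauto⟩
  exact ⟨u, hu, v, hv', by simpa using hv, huv⟩

/-! ### Edge counts and 3-edge-connectivity -/

/-- The number of edges from `A` to `B`, counted as ordered pairs. -/
noncomputable def numBetween (G : SimpleGraph V) (A B : Set V) : ℕ :=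
  {p : V × V | p.1 ∈ A ∧ p.2 ∈ B ∧ G.Adj p.1 p.2}.ncard

theorem numBetween_comm (G : SimpleGraph V) (A B : Set V) :
    G.numBetween A B = G.numBetween B A := by
  refine Set.ncard_congr (fun p _ => p.swap) ?_ ?_ ?_
  · rintro ⟨a, b⟩ ⟨h1, h2, h3⟩
    exact ⟨h2, h1, h3.symm⟩
  · rintro p q _ _ h
    exact Prod.swap_injective h
  · rintro ⟨a, b⟩ ⟨h1, h2, h3⟩
    exact ⟨(b, a), ⟨h2, h1, h3.symm⟩, rfl⟩

theorem numBetween_mono [Finite V] (G : SimpleGraph V) {A B A' B' : Set V} (hA : A ⊆ A')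
    (hB : B ⊆ B') : G.numBetween A B ≤ G.numBetween A' B' :=
  Set.ncard_le_ncard (fun _ h => ⟨hA h.1, hB h.2.1, h.2.2⟩) (Set.toFinite _)

theorem numBetween_singleton_left (G : SimpleGraph V) (a : V) (B : Set V) :
    G.numBetween {a} B = (G.neighborSet a ∩ B).ncard := by
  symm
  refine Set.ncard_congr (fun v _ => (a, v)) ?_ ?_ ?_
  · rintro v ⟨h1, h2⟩
    exact ⟨rfl, h2, h1⟩
  · rintro v w _ _ h
    exact (Prod.mk.inj h).2
  · rintro ⟨x, v⟩ ⟨rfl, h2, h3⟩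
    exact ⟨v, ⟨h3, h2⟩, rfl⟩

theorem numBetween_union_left [Finite V] (G : SimpleGraph V) {A A' : Set V} (h : Disjoint A A')
    (B : Set V) : G.numBetween (A ∪ A') B = G.numBetween A B + G.numBetween A' B := by
  unfold numBetween
  rw [← Set.ncard_union_eq ?_ (Set.toFinite _) (Set.toFinite _)]
  · congr 1
    ext p
    simp only [Set.mem_ofPred_eq, Set.mem_union]
    tauto
  · rw [Set.disjoint_left] at h ⊢
    exact fun p hp hp' => h hp.1 hp'.1

theorem numBetween_union_right [Finite V] (G : SimpleGraph V) {B B' : Set V} (A : Set V)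
    (h : Disjoint B B') : G.numBetween A (B ∪ B') = G.numBetween A B + G.numBetween A B' := by
  rw [numBetween_comm, numBetween_union_left G h, numBetween_comm, numBetween_comm G B']

/-- A cubic `3`-connected graph is `3`-edge-connected. -/
theorem IsKConnected.three_le_numBetween_compl [Finite V] {G : SimpleGraph V}
    (h : G.IsKConnected 3) (hc : G.IsCubic) (A : Set V) (hA : A.Nonempty) (hA' : Aᶜ.Nonempty) :
    3 ≤ G.numBetween A Aᶜ := by
  by_contra! hlt
  -- The ends in A of the edges leaving A. There are at most two, so they cannot separate the rest
  -- of A from the complement; hence A = T has at most two vertices.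
  set T : Set V := {u | u ∈ A ∧ ∃ v ∈ Aᶜ, G.Adj u v} with hT
  have hTle : T.ncard ≤ G.numBetween A Aᶜ := by
    have : T ⊆ Prod.fst '' {p : V × V | p.1 ∈ A ∧ p.2 ∈ Aᶜ ∧ G.Adj p.1 p.2} := by
      rintro u ⟨hu, v, hv, huv⟩
      exact ⟨(u, v), ⟨hu, hv, huv⟩, rfl⟩
    exact (Set.ncard_le_ncard this (Set.toFinite _)).trans (Set.ncard_image_le (Set.toFinite _))
  have hAT : A ⊆ T := by
    by_contra hne
    obtain ⟨a, ha, haT⟩ := Set.not_subset.1 hne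
    obtain ⟨b, hb⟩ := hA'
    obtain ⟨u, ⟨hu, huT⟩, v, hv, hvT, huv⟩ := h.exists_adj T (Set.toFinite _) (by omega) (A \ T)
      Set.disjoint_sdiff_left ⟨a, ha, haT⟩ ⟨b, by
        rintro (hb' | hb')
        · exact hb hb'.1
        · exact hb hb'.1⟩
    exact huT ⟨hu, v, fun hvA => hv ⟨hvA, hvT⟩, huv⟩
  have hA2 : A.ncard ≤ 2 := (Set.ncard_le_ncard hAT (Set.toFinite _)).trans (by omega)
  have hA0 : A.ncard ≠ 0 := by
    exact (Set.ncard_pos (Set.toFinite _)).2 hA |>.ne'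
  -- A vertex of A has at most one neighbour inside A, hence at least two outside; two such vertices
  -- already give four crossing edges.
  have key : ∀ a b, (∀ x ∈ A, x = a ∨ x = b) → 2 ≤ G.numBetween {a} Aᶜ := by
    intro a b hab
    rw [numBetween_singleton_left]
    have h1 := Set.pred_ncard_le_ncard_sdiff_singleton (G.neighborSet a) b
    rw [hc a] at h1
    refine le_trans h1 (Set.ncard_le_ncard ?_ (Set.toFinite _))
    rintro x ⟨hx, hxb⟩
    refine ⟨hx, fun hxA => ?_⟩
    rcases hab x hxA with rfl | rfl
    · exact G.loopless.irrefl _ hx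
    · exact hxb rfl
  obtain h1 | h1 : A.ncard = 1 ∨ A.ncard = 2 := by omega
  · obtain ⟨a, rfl⟩ := Set.ncard_eq_one.1 h1
    rw [numBetween_singleton_left] at hlt
    have : G.neighborSet a ∩ {a}ᶜ = G.neighborSet a := by
      rw [Set.inter_eq_left]
      rintro x hx rfl
      exact G.loopless.irrefl _ hx
    rw [this, hc a] at hlt
    omega
  · obtain ⟨a, b, hab, rfl⟩ := Set.ncard_eq_two.1 h1
    have ha := key a b (by simp)
    have hb := key b a (by simp)
    have := numBetween_union_left G (A := {a}) (A' := {b}) (by simpa using hab) ({a, b}ᶜ : Set V)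
    rw [Set.singleton_union] at this
    omega

/-! ### Contractible edges and 3-separators -/

theorem contractEdge_mk_eq {u v a b : V} :
    Quotient.mk (contractSetoid s(u, v)) a = Quotient.mk (contractSetoid s(u, v)) b ↔
      a = b ∨ ((a = u ∨ a = v) ∧ (b = u ∨ b = v)) := by
  rw [Quotient.eq]
  change (a = b ∨ _) ↔ _
  simp

theorem card_contractSetoid [Finite V] {u v : V} (h : u ≠ v) :
    Nat.card (Quotient (contractSetoid s(u, v))) + 1 = Nat.card V := by
  have h1 : Function.Bijective (fun x : ({v}ᶜ : Set V) =>
      Quotient.mk (contractSetoid s(u, v)) x.1) := by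
    constructor
    · rintro ⟨a, ha⟩ ⟨b, hb⟩ hab
      simp only [contractEdge_mk_eq] at hab
      simp only [Set.mem_compl_iff, Set.mem_singleton_iff] at ha hb
      simp only [Subtype.mk.injEq]
      rcases hab with h | ⟨h1 | h1, h2 | h2⟩ <;> simp_all
    · intro q
      induction q using Quotient.inductionOn with
      | h a =>
        by_cases hav : a = v
        · exact ⟨⟨u, h⟩, contractEdge_mk_eq.2 (by simp [hav])⟩
        · exact ⟨⟨a, hav⟩, rfl⟩
  rw [← Nat.card_congr (Equiv.ofBijective _ h1), Nat.card_coe_set_eq,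
    ← Set.ncard_add_ncard_compl ({v} : Set V), Set.ncard_singleton, add_comm]

/-- A set of at most two vertices of G/uv either contains the merged vertex and pulls back to {u, v}
or {u, v, z}, or avoids it and pulls back to a set of the same size. Connectedness of the complement
then passes down the quotient map. Five vertices are needed so that the quotient has more than
three. -/
theorem isKContractible_three_of_forall [Finite V] {G : SimpleGraph V} (h : G.IsKConnected 3)
    (hV : 5 ≤ Nat.card V) {u v : V} (huv : G.Adj u v)
    (hz : ∀ z, z ≠ u → z ≠ v → (G.induce {w | w ≠ u ∧ w ≠ v ∧ w ≠ z}).Connected) :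
    G.IsKContractible 3 s(u, v) := by
  classical
  refine ⟨huv, ?_, ?_⟩
  · have := card_contractSetoid huv.ne
    omega
  intro T hT
  have : Fintype V := Fintype.ofFinite V
  set q : V → Quotient (contractSetoid s(u, v)) := Quotient.mk _ with hq
  have huvq : q u = q v := contractEdge_mk_eq.2 (by simp)
  suffices hs : (G.induce {w | q w ∉ T}).Connected by
    refine hs.of_surjective_collapse (fun x => ⟨q x.1, x.2⟩) ?_ ?_
    · rintro ⟨y, hy⟩
      obtain ⟨x, rfl⟩ := Quotient.exists_rep y
      exact ⟨⟨x, hy⟩, rfl⟩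
    · rintro ⟨x, hx⟩ ⟨y, hy⟩ hxy
      by_cases hxy' : q x = q y
      · exact Or.inl (Subtype.ext hxy')
      · exact Or.inr ⟨hxy', x, y, rfl, rfl, hxy⟩
  by_cases huT : q u ∈ T
  · obtain hT1 | ⟨t, ht⟩ : (T.erase (q u)) = ∅ ∨ ∃ t, T.erase (q u) = {t} := by
      have h1 := Finset.card_erase_of_mem huT
      rcases Nat.lt_or_ge (T.erase (q u)).card 1 with h2 | h2
      · left
        rw [← Finset.card_eq_zero]
        omega
      · right
        rw [← Finset.card_eq_one]
        omega
    · have hTu : T = {q u} := by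
        rw [← Finset.insert_erase huT, hT1]
        rfl
      have := h.2 {u, v} (lt_of_le_of_lt (Finset.card_le_two) (by norm_num))
      have hS : {w | q w ∉ T} = {w | w ∉ ({u, v} : Finset V)} := by
        ext x
        simp only [hTu, Finset.mem_singleton, hq, contractEdge_mk_eq, Set.mem_ofPred_eq,
          Finset.mem_insert]
        tauto
      rwa [hS]
    · obtain ⟨z, rfl⟩ := Quotient.exists_rep t
      have hne : q z ≠ q u := by
        have : q z ∈ T.erase (q u) := by rw [ht]; simp [hq]
        exact (Finset.mem_erase.1 this).1
      have hTu : T = {q u, q z} := by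
        rw [← Finset.insert_erase huT, ht]
      have hzu : z ≠ u := fun h => hne (by rw [h])
      have hzv : z ≠ v := fun h => hne (by rw [h, huvq])
      have hS : {w | q w ∉ T} = {w | w ≠ u ∧ w ≠ v ∧ w ≠ z} := by
        ext x
        simp only [hTu, Finset.mem_singleton, hq, contractEdge_mk_eq, Set.mem_ofPred_eq,
          Finset.mem_insert]
        grind
      rw [hS]
      exact hz z hzu hzv
  · have hinj : Set.InjOn q {w | q w ∈ T} := by
      intro a ha b hb hab
      rcases contractEdge_mk_eq.1 hab with h | ⟨h1, h2⟩
      · exact h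
      · exfalso
        apply huT
        rcases h1 with rfl | rfl
        · exact ha
        · rw [huvq]; exact ha
    have := h.2 (Finset.univ.filter fun w => q w ∈ T) (lt_of_le_of_lt
      (Finset.card_le_card_of_injOn q (fun a ha => by simpa using ha)
        (by simpa [Set.InjOn] using hinj)) hT)
    have hS : {w | q w ∉ T} = {w | w ∉ Finset.univ.filter fun w => q w ∈ T} := by
      ext x
      simp
    rwa [hS]

/-- In G/uv the vertex w has no neighbours besides the merged vertex and z, so deleting these two
isolates it from t. -/
theorem not_isKContractible_three_of_neighborSet_subset {G : SimpleGraph V} {u v w z t : V}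
    (hw : G.neighborSet w ⊆ {u, v, z}) (hwu : w ≠ u) (hwv : w ≠ v) (hwz : w ≠ z)
    (htu : t ≠ u) (htv : t ≠ v) (htz : t ≠ z) (htw : t ≠ w) :
    ¬ G.IsKContractible 3 s(u, v) := by
  classical
  rintro ⟨-, -, h⟩
  set q : V → Quotient (contractSetoid s(u, v)) := Quotient.mk _ with hq
  have hc := h {q u, q z} (lt_of_le_of_lt (Finset.card_le_two) (by norm_num))
  rw [induce_connected_iff_forall_cut] at hc
  have hne : ∀ {a b}, a ≠ u → a ≠ v → a ≠ b → q a ≠ q b := by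
    intro a b h1 h2 h3 h4
    rcases contractEdge_mk_eq.1 h4 with h | h
    · exact h3 h
    · tauto
  obtain ⟨_, rfl, y, ⟨hy1, -⟩, -, a, b, ha, hb, hab⟩ := hc.2 {q w}
    (by rintro _ rfl; simp [hne hwu hwv hwu, hne hwu hwv hwz]) ⟨_, rfl⟩
    ⟨q t, by simp [hne htu htv htu, hne htu htv htz], hne htu htv htw⟩
  have haw : a = w := by
    by_contra hcon
    exact hne hwu hwv (Ne.symm hcon) ha.symm
  subst haw
  have huvq : q u = q v := contractEdge_mk_eq.2 (by simp)
  have := hw hab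
  simp only [Set.mem_ofPred_eq, ← hb, Finset.mem_insert, Finset.mem_singleton] at hy1
  simp only [Set.mem_insert_iff, Set.mem_singleton_iff] at this
  rcases this with rfl | rfl | rfl
  · exact hy1 (Or.inl rfl)
  · exact hy1 (Or.inl huvq.symm)
  · exact hy1 (Or.inr rfl)

/-- Trading the third separator vertex for a single edge leaves only edge counts to deal with, which
suit the crossing argument. -/
theorem exists_partition_of_not_isKContractible [Finite V] {G : SimpleGraph V}
    (h : G.IsKConnected 3) (hc : G.IsCubic) (hV : 5 ≤ Nat.card V) {u v : V} (huv : G.Adj u v)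
    (hn : ¬ G.IsKContractible 3 s(u, v)) :
    ∃ X Y : Set V, X.Nonempty ∧ Y.Nonempty ∧ Disjoint X Y ∧ X ∪ Y = {u, v}ᶜ ∧
      G.numBetween X Y ≤ 1 := by
  have hz : ∃ z, z ≠ u ∧ z ≠ v ∧ ¬ (G.induce {w | w ≠ u ∧ w ≠ v ∧ w ≠ z}).Connected := by
    by_contra! hcon
    exact hn (isKContractible_three_of_forall h hV huv hcon)
  obtain ⟨z, hzu, hzv, hz⟩ := hz
  rw [induce_connected_iff_forall_cut] at hz
  push Not at hz
  obtain ⟨A, hA, hA1, hA2, hAB⟩ := hz (by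
    by_contra hcon
    have h1 : ({u, v, z} : Set V) = Set.univ := by
      rw [Set.eq_univ_iff_forall]
      intro x
      by_contra hx
      exact hcon ⟨x, by simpa using hx⟩
    have h2 := Set.ncard_univ V
    rw [← h1] at h2
    have h3 := Set.ncard_insert_le u {v, z}
    have h4 := Set.ncard_insert_le v {z}
    rw [Set.ncard_singleton] at h4
    omega)
  set B := {w | w ≠ u ∧ w ≠ v ∧ w ≠ z} \ A with hB
  have hAB' : Disjoint A B := Set.disjoint_sdiff_right
  have hAz : z ∉ A := fun hz => (hA hz).2.2 rfl
  have hBz : z ∉ B := fun hz => hz.1.2.2 rfl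
  have h0 : G.numBetween A B = 0 := by
    rw [numBetween, Set.ncard_eq_zero (Set.toFinite _), Set.eq_empty_iff_forall_notMem]
    rintro ⟨a, b⟩ ⟨h1, h2, h3⟩
    exact hAB a h1 b h2 h3
  have hzAB : G.numBetween {z} A + G.numBetween {z} B ≤ 3 := by
    rw [← numBetween_union_right G _ hAB', numBetween_singleton_left, ← hc z]
    exact Set.ncard_le_ncard Set.inter_subset_left (Set.toFinite _)
  have hU : A ∪ B ∪ {z} = {u, v}ᶜ := by
    ext x
    by_cases hxz : x = z
    · simp [hxz, hzu, hzv]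
    · by_cases hxA : x ∈ A
      · simpa [hxA] using And.intro (hA hxA).1 (hA hxA).2.1
      · simp [hB, hxz, hxA]
  rcases Nat.lt_or_ge 1 (G.numBetween {z} A) with h1 | h1
  -- Here z has at least two neighbours in A, hence at most one in B, so z joins A; in the other
  -- case it joins B.
  · refine ⟨B, A ∪ {z}, hA2, hA1.inl, ?_, ?_, ?_⟩
    · rw [Set.disjoint_union_right]
      exact ⟨hAB'.symm, by simpa using hBz⟩
    · rw [← hU]
      ext x
      simp only [Set.mem_union]
      tauto
    · rw [numBetween_union_right G _ (by simpa using hAz), numBetween_comm, h0, numBetween_comm]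
      omega
  · refine ⟨A, B ∪ {z}, hA1, hA2.inl, ?_, ?_, ?_⟩
    · rw [Set.disjoint_union_right]
      exact ⟨hAB', by simpa using hAz⟩
    · rw [← hU, Set.union_assoc]
    · rw [numBetween_union_right G _ (by simpa using hBz), h0, numBetween_comm]
      omega

/-! ### Crossing separations at two adjacent edges -/

/-- Every edge count between unions of classes becomes a sum of entries of one symmetric matrix, so
all constraints are linear in these entries. -/
theorem numBetween_colorClasses [Finite V] (G : SimpleGraph V) {ι : Type*} [DecidableEq ι]
    (c : V → ι) (P Q : Finset ι) :
    G.numBetween {v | c v ∈ P} {v | c v ∈ Q} =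
      ∑ i ∈ P, ∑ j ∈ Q, G.numBetween {v | c v = i} {v | c v = j} := by
  have empty : ∀ B, G.numBetween ∅ B = 0 := fun B => by simp [numBetween]
  have right : ∀ A, G.numBetween A {v | c v ∈ Q} = ∑ j ∈ Q, G.numBetween A {v | c v = j} := by
    intro A
    induction Q using Finset.induction_on with
    | empty => simpa [numBetween_comm G A] using empty A
    | insert i Q hi ih =>
      rw [Finset.sum_insert hi, ← ih, ← numBetween_union_right]
      · congr 1
        ext x
        simp
      · rw [Set.disjoint_left]
        rintro x rfl
        exact hi
  induction P using Finset.induction_on with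
  | empty => simpa using empty _
  | insert i P hi ih =>
    rw [Finset.sum_insert hi, ← ih, ← right, ← numBetween_union_left]
    · congr 1
      ext x
      simp
    · rw [Set.disjoint_left]
      rintro x rfl
      exact hi

/-- Colour classes `0`, `1`, `2` are the single vertices `y`, `x`, `w`, and the other four are the
intersections of the sides of a separation at `xy` with those of a separation at `yw`. -/
theorem false_of_crossing_separations [Finite V] {G : SimpleGraph V}
    (h : G.IsKConnected 3) (hc : G.IsCubic) {x y w : V} (hxy : G.Adj x y) (hyw : G.Adj y w)
    (hnot : ¬ G.Adj x w) (c : V → Fin 7)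
    (hy : ∀ v, c v = 0 ↔ v = y) (hx : ∀ v, c v = 1 ↔ v = x) (hw : ∀ v, c v = 2 ↔ v = w)
    (h56 : ∃ v, c v = 5 ∨ c v = 6) (h46 : ∃ v, c v = 4 ∨ c v = 6)
    (hX : G.numBetween {v | c v ∈ ({2, 3, 4} : Finset (Fin 7))}
      {v | c v ∈ ({5, 6} : Finset (Fin 7))} ≤ 1)
    (hC : G.numBetween {v | c v ∈ ({1, 3, 5} : Finset (Fin 7))}
      {v | c v ∈ ({4, 6} : Finset (Fin 7))} ≤ 1) : False := by
  have hy0 := (hy y).2 rfl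
  obtain ⟨N, hN⟩ : ∃ N : Fin 7 → Fin 7 → ℕ,
    ∀ i j, G.numBetween {v | c v = i} {v | c v = j} = N i j := ⟨_, fun _ _ => rfl⟩
  have sym : ∀ i j, N i j = N j i := fun i j => by
    rw [← hN, ← hN, numBetween_comm]
  have col : ∀ P Q : Finset (Fin 7), G.numBetween {v | c v ∈ P} {v | c v ∈ Q} =
      ∑ i ∈ P, ∑ j ∈ Q, N i j := fun P Q => by
    rw [numBetween_colorClasses]
    simp only [hN]
  -- 3-edge-connectivity for a union of classes; y, which has colour 0, witnesses that the
  -- complement is nonempty.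
  have cut : ∀ P Q : Finset (Fin 7), Pᶜ = Q → 0 ∈ Q → (∃ v, c v ∈ P) →
      3 ≤ ∑ i ∈ P, ∑ j ∈ Q, N i j := by
    rintro P Q rfl h0 hP
    rw [← col]
    have hset : {v | c v ∈ Pᶜ} = {v | c v ∈ P}ᶜ := by
      ext v
      simp
    rw [hset]
    exact h.three_le_numBetween_compl hc _ hP ⟨y, by simpa [hy0] using h0⟩
  have cls : ∀ i : Fin 7, (∀ j, N i j = 0) ∨ ∃ v, c v = i := by
    intro i
    by_cases hi : ∃ v, c v = i
    · exact Or.inr hi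
    · left
      intro j
      rw [← hN, numBetween, Set.ncard_eq_zero (Set.toFinite _), Set.eq_empty_iff_forall_notMem]
      exact fun p hp => hi ⟨p.1, hp.1⟩
  have deg : ∀ (v : V) (i : Fin 7), (∀ a, c a = i ↔ a = v) →
      ∑ j ∈ ({0, 1, 2, 3, 4, 5, 6} : Finset (Fin 7)), N i j = 3 := by
    intro v i hi
    have h1 := col {i} {0, 1, 2, 3, 4, 5, 6}
    rw [Finset.sum_singleton] at h1
    rw [← h1]
    have h2 : {a | c a ∈ ({i} : Finset (Fin 7))} = {v} := by
      ext a
      simp [hi]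
    have h3 : {a | c a ∈ ({0, 1, 2, 3, 4, 5, 6} : Finset (Fin 7))} = Set.univ := by
      rw [Set.eq_univ_iff_forall]
      intro a
      exact (by decide : ∀ k : Fin 7, k ∈ ({0, 1, 2, 3, 4, 5, 6} : Finset (Fin 7))) (c a)
    rw [h2, h3, numBetween_singleton_left, Set.inter_univ, hc v]
  have pair : ∀ (u v : V) (i j : Fin 7), (∀ a, c a = i ↔ a = u) → (∀ a, c a = j ↔ a = v) →
      N i j = ({v' | v' = v ∧ G.Adj u v} : Set V).ncard := by
    intro u v i j hi hj
    rw [← hN]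
    have h2 : {a | c a = i} = {u} := by
      ext a
      simp [hi]
    have h3 : {a | c a = j} = {v} := by
      ext a
      simp [hj]
    rw [h2, h3, numBetween_singleton_left]
    congr 1
    ext a
    simp only [Set.mem_inter_iff, mem_neighborSet, Set.mem_singleton_iff, Set.mem_ofPred_eq]
    constructor
    · rintro ⟨h, rfl⟩
      exact ⟨rfl, h⟩
    · rintro ⟨rfl, h⟩
      exact ⟨h, rfl⟩
  have n00 : N 0 0 = 0 := by simp [pair y y 0 0 hy hy]
  have n11 : N 1 1 = 0 := by simp [pair x x 1 1 hx hx]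
  have n22 : N 2 2 = 0 := by simp [pair w w 2 2 hw hw]
  have n01 : N 0 1 = 1 := by simp [pair y x 0 1 hy hx, hxy.symm]
  have n02 : N 0 2 = 1 := by simp [pair y w 0 2 hy hw, hyw]
  have n12 : N 1 2 = 0 := by simp [pair x w 1 2 hx hw, hnot]
  have d0 := deg y 0 hy
  have d1 := deg x 1 hx
  have d2 := deg w 2 hw
  rw [col] at hX hC
  -- In terms of the two separations these six sets are Y, Y + x, D, D + w, X and C.
  have c56 := cut {5, 6} {0, 1, 2, 3, 4} (by decide) (by decide) (by simpa using h56)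
  have c156 := cut {1, 5, 6} {0, 2, 3, 4} (by decide) (by decide) ⟨x, by simp [(hx x).2 rfl]⟩
  have c46 := cut {4, 6} {0, 1, 2, 3, 5} (by decide) (by decide) (by simpa using h46)
  have c246 := cut {2, 4, 6} {0, 1, 3, 5} (by decide) (by decide) ⟨w, by simp [(hw w).2 rfl]⟩
  have c234 := cut {2, 3, 4} {0, 1, 5, 6} (by decide) (by decide) ⟨w, by simp [(hw w).2 rfl]⟩
  have c135 := cut {1, 3, 5} {0, 2, 4, 6} (by decide) (by decide) ⟨x, by simp [(hx x).2 rfl]⟩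
  have c3 := cut {3} {0, 1, 2, 4, 5, 6} (by decide) (by decide)
  have c4 := cut {4} {0, 1, 2, 3, 5, 6} (by decide) (by decide)
  have c5 := cut {5} {0, 1, 2, 3, 4, 6} (by decide) (by decide)
  have c6 := cut {6} {0, 1, 2, 3, 4, 5} (by decide) (by decide)
  -- A corner may be empty; then its row vanishes, and otherwise it sends out at least three edges.
  have k3 : (N 3 0 = 0 ∧ N 3 1 = 0 ∧ N 3 2 = 0 ∧ N 3 4 = 0 ∧ N 3 5 = 0 ∧ N 3 6 = 0) ∨
      3 ≤ N 3 0 + N 3 1 + N 3 2 + N 3 4 + N 3 5 + N 3 6 := by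
    rcases cls 3 with h | h
    · simp [h]
    · right
      simpa [add_assoc] using c3 (by simpa using h)
  have k4 : (N 4 0 = 0 ∧ N 4 1 = 0 ∧ N 4 2 = 0 ∧ N 4 3 = 0 ∧ N 4 5 = 0 ∧ N 4 6 = 0) ∨
      3 ≤ N 4 0 + N 4 1 + N 4 2 + N 4 3 + N 4 5 + N 4 6 := by
    rcases cls 4 with h | h
    · simp [h]
    · right
      simpa [add_assoc] using c4 (by simpa using h)
  have k5 : (N 5 0 = 0 ∧ N 5 1 = 0 ∧ N 5 2 = 0 ∧ N 5 3 = 0 ∧ N 5 4 = 0 ∧ N 5 6 = 0) ∨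
      3 ≤ N 5 0 + N 5 1 + N 5 2 + N 5 3 + N 5 4 + N 5 6 := by
    rcases cls 5 with h | h
    · simp [h]
    · right
      simpa [add_assoc] using c5 (by simpa using h)
  have k6 : (N 6 0 = 0 ∧ N 6 1 = 0 ∧ N 6 2 = 0 ∧ N 6 3 = 0 ∧ N 6 4 = 0 ∧ N 6 5 = 0) ∨
      3 ≤ N 6 0 + N 6 1 + N 6 2 + N 6 3 + N 6 4 + N 6 5 := by
    rcases cls 6 with h | h
    · simp [h]
    · right
      simpa [add_assoc] using c6 (by simpa using h)
  clear c3 c4 c5 c6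
  have s10 := sym 1 0
  have s20 := sym 2 0
  have s30 := sym 3 0
  have s40 := sym 4 0
  have s50 := sym 5 0
  have s60 := sym 6 0
  have s21 := sym 2 1
  have s31 := sym 3 1
  have s41 := sym 4 1
  have s51 := sym 5 1
  have s61 := sym 6 1
  have s32 := sym 3 2
  have s42 := sym 4 2
  have s52 := sym 5 2
  have s62 := sym 6 2
  have s43 := sym 4 3
  have s53 := sym 5 3
  have s63 := sym 6 3
  have s54 := sym 5 4
  have s64 := sym 6 4
  have s65 := sym 6 5
  simp [← add_assoc, s10, s20, s30, s40, s50, s60, s21, s31, s41, s51, s61, s32, s42, s52, s62,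
    s43, s53, s63, s54, s64, s65, n00, n11, n22, n01, n02, n12]
    at d0 d1 d2 hX hC c56 c156 c46 c246 c234 c135 k3 k4 k5 k6
  clear s10 s20 s30 s40 s50 s60 s21 s31 s41 s51 s61 s32 s42 s52 s62 s43 s53 s63 s54 s64 s65
  -- Sixteen cases, according to which corners are empty; in each the linear system is infeasible.
  rcases k4 with k4 | k4 <;> rcases k5 with k5 | k5 <;> rcases k3 with k3 | k3 <;>
    rcases k6 with k6 | k6 <;> omega

/-- The normalised case: X names the side of the first separation containing w, and C the side of
the second containing x. The other placements follow by renaming sides. -/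
theorem adj_of_separations [Finite V] {G : SimpleGraph V}
    (h : G.IsKConnected 3) (hc : G.IsCubic) {x y w : V} (hxy : G.Adj x y) (hyw : G.Adj y w)
    (hxw : x ≠ w) {X Y C D : Set V} (hY : Y.Nonempty) (hXY : Disjoint X Y)
    (hXYu : X ∪ Y = {x, y}ᶜ) (hXYn : G.numBetween X Y ≤ 1) (hD : D.Nonempty)
    (hCD : Disjoint C D) (hCDu : C ∪ D = {y, w}ᶜ) (hCDn : G.numBetween C D ≤ 1)
    (hwX : w ∈ X) (hxC : x ∈ C) : G.Adj x w := by
  classical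
  by_contra hnot
  have hyx := hxy.ne'
  have hyw' := hyw.ne
  have mXY : ∀ v, (v ∈ X ∨ v ∈ Y) ↔ (v ≠ x ∧ v ≠ y) := fun v => by
    have := Set.ext_iff.1 hXYu v
    simpa using this
  have mCD : ∀ v, (v ∈ C ∨ v ∈ D) ↔ (v ≠ y ∧ v ≠ w) := fun v => by
    have := Set.ext_iff.1 hCDu v
    simpa using this
  have dXY : ∀ v, v ∈ X → v ∉ Y := fun _ hv => Set.disjoint_left.1 hXY hv
  have dCD : ∀ v, v ∈ C → v ∉ D := fun _ hv => Set.disjoint_left.1 hCD hv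
  -- Apart from y, x and w, a vertex outside X lies in Y and one outside C lies in D, so the
  -- negative branches do describe the corners.
  set c : V → Fin 7 := fun v => if v = y then 0 else if v = x then 1 else if v = w then 2 else
    if v ∈ X then (if v ∈ C then 3 else 4) else (if v ∈ C then 5 else 6) with hcdef
  have c0 : ∀ v, c v = 0 ↔ v = y := by
    intro v
    simp only [hcdef]
    split_ifs <;> simp_all
  have c1 : ∀ v, c v = 1 ↔ v = x := by
    intro v
    simp only [hcdef]
    split_ifs <;> simp_all
  have c2 : ∀ v, c v = 2 ↔ v = w := by
    intro v
    simp only [hcdef]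
    split_ifs <;> simp_all
  have val : ∀ v, (v = y ∧ c v = 0) ∨ (v = x ∧ c v = 1) ∨ (v = w ∧ c v = 2) ∨
      (v ∈ X ∧ v ∈ C ∧ c v = 3) ∨ (v ∈ X ∧ v ∈ D ∧ c v = 4) ∨
      (v ∈ Y ∧ v ∈ C ∧ c v = 5) ∨ (v ∈ Y ∧ v ∈ D ∧ c v = 6) := by
    intro v
    have h1 := mXY v
    have h2 := mCD v
    by_cases e1 : v = y
    · exact Or.inl ⟨e1, (c0 v).2 e1⟩
    by_cases e2 : v = x
    · exact Or.inr (Or.inl ⟨e2, (c1 v).2 e2⟩)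
    by_cases e3 : v = w
    · exact Or.inr (Or.inr (Or.inl ⟨e3, (c2 v).2 e3⟩))
    by_cases e4 : v ∈ X <;> by_cases e5 : v ∈ C <;> simp_all
  have hYc : ∀ v, v ∈ Y → c v = 5 ∨ c v = 6 := by
    intro v hv
    have h2 : v ∉ X := fun hX => dXY v hX hv
    have h3 : v ≠ x ∧ v ≠ y := (mXY v).1 (Or.inr hv)
    have h4 : v ≠ w := fun e => h2 (e ▸ hwX)
    rcases val v with h | h | h | h | h | h | h <;> tauto
  have hDc : ∀ v, v ∈ D → c v = 4 ∨ c v = 6 := by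
    intro v hv
    have h2 : v ∉ C := fun hC => dCD v hC hv
    have h3 : v ≠ y ∧ v ≠ w := (mCD v).1 (Or.inr hv)
    have h4 : v ≠ x := fun e => h2 (e ▸ hxC)
    rcases val v with h | h | h | h | h | h | h <;> tauto
  clear_value c
  refine false_of_crossing_separations h hc hxy hyw hnot c c0 c1 c2 ?_ ?_ ?_ ?_
  · obtain ⟨v, hv⟩ := hY
    exact ⟨v, hYc v hv⟩
  · obtain ⟨v, hv⟩ := hD
    exact ⟨v, hDc v hv⟩
  · refine le_trans (numBetween_mono G ?_ ?_) hXYn <;> intro v hv <;>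
      rw [Set.mem_ofPred_eq] at hv <;>
      rcases val v with ⟨e, h⟩ | ⟨e, h⟩ | ⟨e, h⟩ | ⟨e, -, h⟩ | ⟨e, -, h⟩ | ⟨e, -, h⟩ | ⟨e, -, h⟩ <;>
      first
      | exact e
      | exact e ▸ hwX
      | (rw [h] at hv; exact absurd hv (by decide))
  · refine le_trans (numBetween_mono G ?_ ?_) hCDn <;> intro v hv <;>
      rw [Set.mem_ofPred_eq] at hv <;>
      rcases val v with ⟨e, h⟩ | ⟨e, h⟩ | ⟨e, h⟩ | ⟨-, e, h⟩ | ⟨-, e, h⟩ | ⟨-, e, h⟩ | ⟨-, e, h⟩ <;>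
      first
      | exact e
      | exact e ▸ hxC
      | (rw [h] at hv; exact absurd hv (by decide))

/-- In a cubic `3`-connected graph, two adjacent noncontractible edges lie in a triangle. -/
theorem adj_of_not_isKContractible [Finite V] {G : SimpleGraph V}
    (h : G.IsKConnected 3) (hc : G.IsCubic) (hV : 5 ≤ Nat.card V) {x y w : V}
    (hxy : G.Adj x y) (hyw : G.Adj y w) (hxw : x ≠ w) (hn : ¬ G.IsKContractible 3 s(x, y))
    (hn' : ¬ G.IsKContractible 3 s(y, w)) : G.Adj x w := by
  obtain ⟨X, Y, hX, hY, hXY, hu, hXYn⟩ := exists_partition_of_not_isKContractible h hc hV hxy hn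
  obtain ⟨C, D, hC, hD, hCD, hu', hCDn⟩ :=
    exists_partition_of_not_isKContractible h hc hV hyw hn'
  have hw : w ∈ X ∪ Y := by
    rw [hu]
    simp [hxw.symm, hyw.ne']
  have hx : x ∈ C ∪ D := by
    rw [hu']
    simp [hxw, hxy.ne]
  rcases hw with hw | hw <;> rcases hx with hx | hx
  · exact adj_of_separations h hc hxy hyw hxw hY hXY hu hXYn hD hCD hu' hCDn hw hx
  · exact adj_of_separations h hc hxy hyw hxw hY hXY hu hXYn hC hCD.symm
      (by rwa [Set.union_comm]) (by rwa [numBetween_comm]) hw hx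
  · exact adj_of_separations h hc hxy hyw hxw hX hXY.symm
      (by rwa [Set.union_comm]) (by rwa [numBetween_comm]) hD hCD hu' hCDn hw hx
  · exact adj_of_separations h hc hxy hyw hxw hX hXY.symm
      (by rwa [Set.union_comm]) (by rwa [numBetween_comm]) hC hCD.symm
      (by rwa [Set.union_comm]) (by rwa [numBetween_comm]) hw hx

/-! ### Diamonds and the lower bound -/

theorem IsCubic.neighborSet_eq {G : SimpleGraph V} (hc : G.IsCubic) {v a b c : V}
    (ha : G.Adj v a) (hb : G.Adj v b) (hc' : G.Adj v c) (hab : a ≠ b) (hac : a ≠ c)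
    (hbc : b ≠ c) : G.neighborSet v = {a, b, c} := by
  symm
  refine Set.eq_of_subset_of_ncard_le ?_ ?_ (Set.finite_of_ncard_ne_zero (by rw [hc v]; simp))
  · rintro x (rfl | rfl | rfl) <;> assumption
  · rw [hc v, Set.ncard_eq_three.2 ⟨a, b, c, hab, hac, hbc, rfl⟩]

/-- The triangles uvw and vwt use up all three edges at v and at w, so {u, t} would separate {v, w}
from any fifth vertex. -/
theorem card_le_four_of_diamond [Finite V] {G : SimpleGraph V} (h : G.IsKConnected 3)
    (hc : G.IsCubic) {u v w t : V} (huv : G.Adj u v) (hvw : G.Adj v w) (huw : G.Adj u w)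
    (hvt : G.Adj v t) (hwt : G.Adj w t) (hut : u ≠ t) : Nat.card V ≤ 4 := by
  by_contra! hcard
  have hv := hc.neighborSet_eq huv.symm hvw hvt huw.ne hut hwt.ne
  have hw := hc.neighborSet_eq huw.symm hvw.symm hwt huv.ne hut hvt.ne
  obtain ⟨a, ha, b, hb, hbT, hab⟩ := h.exists_adj {u, t} (Set.toFinite _)
    (lt_of_le_of_lt (Set.ncard_insert_le _ _) (by simp)) {v, w}
    (by simp [huv.ne, hvt.ne', huw.ne, hwt.ne']) ⟨v, by simp⟩ (by
      by_contra hcon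
      rw [Set.not_nonempty_iff_eq_empty, Set.compl_empty_iff] at hcon
      have h1 := Set.ncard_univ V
      rw [← hcon] at h1
      have h2 := Set.ncard_union_le {v, w} {u, t}
      have h3 := Set.ncard_insert_le v {w}
      have h4 := Set.ncard_insert_le u {t}
      rw [Set.ncard_singleton] at h3 h4
      omega)
  rcases ha with rfl | rfl
  · have : b ∈ G.neighborSet a := hab
    rw [hv] at this
    simp at this hb hbT
    tauto
  · have : b ∈ G.neighborSet a := hab
    rw [hw] at this
    simp at this hb hbT
    tauto

theorem IsCubic.nonempty_iso_top [Finite V] {G : SimpleGraph V} (hc : G.IsCubic)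
    (hV : Nat.card V = 4) : Nonempty (G ≃g (⊤ : SimpleGraph (Fin 4))) := by
  have e := (Finite.equivFinOfCardEq hV)
  have key : ∀ v, G.neighborSet v = {v}ᶜ := by
    intro v
    refine Set.eq_of_subset_of_ncard_le ?_ ?_ (Set.toFinite _)
    · rintro x hx rfl
      exact G.loopless.irrefl _ hx
    · have := Set.ncard_add_ncard_compl ({v} : Set V)
      rw [hc v]
      rw [Set.ncard_singleton, hV] at this
      omega
  refine ⟨⟨e, ?_⟩⟩
  intro a b
  have : b ∈ G.neighborSet a ↔ b ∈ ({a}ᶜ : Set V) := by rw [key]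
  simp only [mem_neighborSet, Set.mem_compl_iff, Set.mem_singleton_iff] at this
  rw [this]
  simp [eq_comm]

/-- If every component is a path with at most three vertices, then at most two thirds as many
edges as vertices. -/
theorem three_mul_card_edgeFinset_le [Fintype V] (F : SimpleGraph V) [DecidableRel F.Adj]
    (h2 : ∀ v, F.degree v ≤ 2) (h1 : ∀ u v, F.Adj u v → F.degree u = 2 → F.degree v = 1) :
    3 * F.edgeFinset.card ≤ 2 * Fintype.card V := by
  have hsum : ∑ v, ∑ u ∈ F.neighborFinset v, F.degree u = ∑ v, F.degree v * F.degree v := by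
    have : ∀ v, ∑ u ∈ F.neighborFinset v, F.degree u = ∑ u, if F.Adj v u then F.degree u else 0 := by
      intro v
      rw [← Finset.sum_filter]
      congr 1
      ext u
      simp
    simp_rw [this]
    rw [Finset.sum_comm]
    refine Finset.sum_congr rfl fun u _ => ?_
    rw [← Finset.sum_filter, Finset.sum_const, smul_eq_mul]
    congr 1
    rw [← card_neighborFinset_eq_degree]
    congr 1
    ext v
    simp [adj_comm]
  -- Summed over v, the neighbour-degree sums on the left cancel the squared degrees on the right by
  -- `hsum`. What remains is 6|E| ≤ 4|V|.
  have key : ∀ v, 3 * F.degree v + ∑ u ∈ F.neighborFinset v, F.degree u ≤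
      4 + F.degree v * F.degree v := by
    intro v
    have hv := h2 v
    obtain h | h | h : F.degree v = 0 ∨ F.degree v = 1 ∨ F.degree v = 2 := by omega
    · have : F.neighborFinset v = ∅ := by
        rw [← Finset.card_eq_zero, card_neighborFinset_eq_degree, h]
      simp [h, this]
    · have : ∑ u ∈ F.neighborFinset v, F.degree u ≤ (F.neighborFinset v).card • 2 :=
        Finset.sum_le_card_nsmul _ _ _ fun u _ => h2 u
      rw [card_neighborFinset_eq_degree, h] at this
      rw [h]
      simp at this
      omega
    · have : ∑ u ∈ F.neighborFinset v, F.degree u ≤ (F.neighborFinset v).card • 1 :=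
        Finset.sum_le_card_nsmul _ _ _ fun u hu =>
          (h1 v u ((mem_neighborFinset _ _ _).1 hu) h).le
      rw [card_neighborFinset_eq_degree, h] at this
      rw [h]
      simp at this
      omega
  have tot := Finset.sum_le_sum fun v (_ : v ∈ Finset.univ) => key v
  rw [Finset.sum_add_distrib, Finset.sum_add_distrib, hsum, ← Finset.mul_sum,
    sum_degrees_eq_twice_card_edges] at tot
  simp at tot
  omega

/-- The lower bound for spanning trees. -/
theorem card_le_numContractible [Finite V] {G : SimpleGraph V} (h : G.IsKConnected 3)
    (hc : G.IsCubic) (hK : ¬ Nonempty (G ≃g (⊤ : SimpleGraph (Fin 4)))) {Q : SimpleGraph V}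
    (hQ : G.IsSpanningTree Q) : Nat.card V ≤ 3 * G.numContractible Q 3 + 3 := by
  classical
  have : Fintype V := Fintype.ofFinite V
  have hV : 5 ≤ Nat.card V := by
    rcases Nat.lt_or_ge 4 (Nat.card V) with h1 | h1
    · exact h1
    · exact absurd (hc.nonempty_iso_top (le_antisymm h1 h.1)) hK
  let F : SimpleGraph V :=
    { Adj := fun u v => Q.Adj u v ∧ ¬ G.IsKContractible 3 s(u, v)
      symm := ⟨fun u v h => ⟨h.1.symm, by rw [Sym2.eq_swap]; exact h.2⟩⟩
      loopless := ⟨fun u h => Q.loopless.irrefl u h.1⟩ }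
  have hFG : ∀ {u v}, F.Adj u v → G.Adj u v := fun h => hQ.1 h.1
  have tri : ∀ {u v w}, F.Adj u v → F.Adj v w → u ≠ w → G.Adj u w := fun h1 h2 h3 =>
    adj_of_not_isKContractible h hc hV (hFG h1) (hFG h2) h3 h1.2 h2.2
  -- A claw centred at v gives the edges uw and wt, hence a diamond on u, v, w, t.
  have deg3 : ∀ {u v w t}, F.Adj v u → F.Adj v w → F.Adj v t → u ≠ w → u ≠ t → w ≠ t → False := by
    intro u v w t hu hw ht huw hut hwt
    have := card_le_four_of_diamond h hc (hFG hu.symm) (hFG hw) (tri hu.symm hw huw) (hFG ht)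
      (tri hw.symm ht hwt) hut
    omega
  -- If u = t, the path closes to a triangle in the tree; otherwise the edges uw and vt complete a
  -- diamond.
  have path4 : ∀ {u v w t}, F.Adj u v → F.Adj v w → F.Adj w t → u ≠ w → v ≠ t → False := by
    intro u v w t huv hvw hwt huw hvt
    by_cases hut : u = t
    · subst hut
      exact hQ.2.isAcyclic.cliqueFree le_rfl {u, v, w}
        (is3Clique_iff.2 ⟨u, v, w, huv.1, hwt.1.symm, hvw.1, rfl⟩)
    · have := card_le_four_of_diamond h hc (hFG huv) (hFG hvw) (tri huv hvw huw)
        (tri hvw hwt hvt) (hFG hwt) hut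
      omega
  have hF := three_mul_card_edgeFinset_le F (fun v => by
      by_contra! hcon
      rw [← card_neighborFinset_eq_degree, Finset.two_lt_card] at hcon
      obtain ⟨a, ha, b, hb, d, hd, hab, had, hbd⟩ := hcon
      simp only [mem_neighborFinset] at ha hb hd
      exact deg3 ha hb hd hab had hbd) (fun u v huv hu => by
      have h1 : ∃ a, F.Adj u a ∧ a ≠ v := by
        rw [← card_neighborFinset_eq_degree] at hu
        obtain ⟨a, ha, hav⟩ := Finset.exists_mem_ne (by omega : 1 < (F.neighborFinset u).card) v
        exact ⟨a, by simpa using ha, hav⟩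
      obtain ⟨a, ha, hav⟩ := h1
      rw [← card_neighborFinset_eq_degree, Finset.card_eq_one]
      refine ⟨u, Finset.eq_singleton_iff_unique_mem.2 ⟨by simpa using huv.symm, fun b hb => ?_⟩⟩
      by_contra hbu
      exact path4 ha.symm huv (by simpa using hb) hav (Ne.symm hbu))
  have hQe : Q.edgeSet.ncard + 1 = Nat.card V := by
    rw [← hQ.2.card_edgeFinset.trans Nat.card_eq_fintype_card.symm, ← coe_edgeFinset,
      Set.ncard_coe_finset]
  have hsplit : Q.edgeSet = {e | e ∈ Q.edgeSet ∧ G.IsKContractible 3 e} ∪ F.edgeSet := by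
    ext e
    induction e using Sym2.ind with
    | _ a b =>
      simp only [mem_edgeSet, Set.mem_union, Set.mem_ofPred_eq, F]
      tauto
  have hle : Q.edgeSet.ncard ≤ G.numContractible Q 3 + F.edgeSet.ncard := by
    conv_lhs => rw [hsplit]
    exact Set.ncard_union_le _ _
  rw [← coe_edgeFinset F, Set.ncard_coe_finset] at hle
  rw [← Nat.card_eq_fintype_card] at hF
  omega

/-! ### The triangle replacement -/

instance [Finite V] (G : SimpleGraph V) : Finite G.Dart :=
  Finite.of_injective _ (Dart.toProd_injective (G := G))

theorem IsCubic.ncard_dart_fst {G : SimpleGraph V} (hc : G.IsCubic) (x : V) :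
    {d : G.Dart | d.fst = x}.ncard = 3 := by
  rw [← hc x]
  refine Set.ncard_congr (fun d _ => d.snd) ?_ ?_ ?_
  · rintro d rfl
    exact d.adj
  · rintro d e rfl he h
    exact Dart.ext _ _ (Prod.ext he.symm h)
  · intro y hy
    exact ⟨⟨(x, y), hy⟩, rfl, rfl⟩

theorem IsCubic.exists_third_dart {G : SimpleGraph V} (hc : G.IsCubic) {d e : G.Dart}
    (hne : d ≠ e) (hfst : d.fst = e.fst) : ∃ c : G.Dart, c.fst = d.fst ∧ c ≠ d ∧ c ≠ e ∧
      ∀ a : G.Dart, a.fst = d.fst → a = d ∨ a = e ∨ a = c := by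
  have hd : d ∈ {a : G.Dart | a.fst = d.fst} := rfl
  have he : e ∈ {a : G.Dart | a.fst = d.fst} := hfst.symm
  have hfin : {a : G.Dart | a.fst = d.fst}.Finite :=
    Set.finite_of_ncard_ne_zero (by rw [hc.ncard_dart_fst]; simp)
  have hpos : 0 < ({a : G.Dart | a.fst = d.fst} \ {d, e}).ncard := by
    rw [Set.ncard_sdiff (by rintro _ (rfl | rfl) <;> assumption) (Set.toFinite _),
      hc.ncard_dart_fst, Set.ncard_pair hne]
    norm_num
  obtain ⟨c, hc1, hc2⟩ := (Set.ncard_pos hfin.sdiff).1 hpos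
  simp only [Set.mem_insert_iff, Set.mem_singleton_iff, not_or] at hc2
  refine ⟨c, hc1, hc2.1, hc2.2, fun a ha => ?_⟩
  have heq : ({d, e, c} : Set G.Dart) = {a : G.Dart | a.fst = d.fst} := by
    refine Set.eq_of_subset_of_ncard_le ?_ ?_ hfin
    · rintro _ (rfl | rfl | rfl) <;> assumption
    · rw [hc.ncard_dart_fst, Set.ncard_eq_three.2
        ⟨d, e, c, hne, Ne.symm hc2.1, Ne.symm hc2.2, rfl⟩]
  have : a ∈ ({d, e, c} : Set G.Dart) := by
    rw [heq]
    exact ha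
  simpa using this

theorem IsCubic.card_dart [Finite V] {G : SimpleGraph V} (hc : G.IsCubic) :
    Nat.card G.Dart = 3 * Nat.card V := by
  classical
  have : Fintype V := Fintype.ofFinite V
  rw [Nat.card_eq_fintype_card, Nat.card_eq_fintype_card, dart_card_eq_sum_degrees]
  have : ∀ v, G.degree v = 3 := by
    intro v
    rw [← hc v, ← card_neighborSet_eq_degree, ← Nat.card_eq_fintype_card, Nat.card_coe_set_eq]
  simp [this, mul_comm]

theorem Dart.fst_symm_ne {G : SimpleGraph V} (d : G.Dart) : d.symm.fst ≠ d.fst :=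
  d.snd_ne_fst

theorem IsCubic.triangleReplacement {G : SimpleGraph V} (hc : G.IsCubic) :
    G.triangleReplacement.IsCubic := by
  intro d
  have hfin : {e : G.Dart | e.fst = d.fst}.Finite :=
    Set.finite_of_ncard_ne_zero (by rw [hc.ncard_dart_fst]; simp)
  have h : G.triangleReplacement.neighborSet d =
      insert d.symm ({e : G.Dart | e.fst = d.fst} \ {d}) := by
    ext e
    simp only [mem_neighborSet, SimpleGraph.triangleReplacement, Set.mem_insert_iff,
      Set.mem_sdiff, Set.mem_ofPred_eq, Set.mem_singleton_iff]
    constructor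
    · rintro (⟨h1, h2⟩ | h)
      · exact Or.inr ⟨h2.symm, h1.symm⟩
      · exact Or.inl h
    · rintro (h | ⟨h1, h2⟩)
      · exact Or.inr h
      · exact Or.inl ⟨Ne.symm h2, h1.symm⟩
  rw [h, Set.ncard_insert_of_notMem (fun h => d.fst_symm_ne h.1) hfin.sdiff,
    Set.ncard_sdiff_singleton_of_mem (by simp), hc.ncard_dart_fst]

/-- Deleting from the triangle replacement darts that lie on at most two edges and cover no
triangle leaves a connected graph. -/
theorem induce_compl_triangleReplacement_connected [Finite V] {G : SimpleGraph V}
    (h : G.IsKConnected 3) (hc : G.IsCubic) (S : Set G.Dart)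
    (hS : ∀ x, ∃ d ∉ S, d.fst = x) (hS2 : (Dart.edge '' S).ncard ≤ 2) :
    (G.triangleReplacement.induce Sᶜ).Connected := by
  rw [induce_connected_iff_forall_cut]
  constructor
  · have : Nonempty V := by
      by_contra hcon
      rw [not_nonempty_iff] at hcon
      have := h.1
      simp at this
    obtain ⟨x⟩ := this
    obtain ⟨d, hd, -⟩ := hS x
    exact ⟨d, hd⟩
  rintro A hA ⟨a, ha⟩ ⟨b, hbS, hbA⟩
  by_contra! hcon
  -- Up to the deleted darts, A is a union of triangles, so it comes from the vertex set B of G.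
  have same : ∀ d ∈ A, ∀ e, e ∉ S → e.fst = d.fst → e ∈ A := by
    intro d hd e he hed
    by_contra heA
    exact hcon d hd e ⟨he, heA⟩ (Or.inl ⟨fun h => heA (h ▸ hd), hed.symm⟩)
  set B : Set V := {x | ∃ d ∈ A, d.fst = x} with hB
  have h3 := h.three_le_numBetween_compl hc B ⟨_, a, ha, rfl⟩
    ⟨b.fst, fun ⟨d, hd, hdb⟩ => hbA (same d hd b hbS hdb.symm)⟩
  -- With no edge of the replacement leaving A, each edge of G leaving B must have a deleted dart;
  -- but at least three edges leave B.
  have hle : G.numBetween B Bᶜ ≤ (Dart.edge '' S).ncard := by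
    refine Set.ncard_le_ncard_of_injOn (fun p => s(p.1, p.2)) ?_ ?_ (Set.toFinite _)
    · rintro ⟨u, v⟩ ⟨⟨d, hd, hdu⟩, hv, huv⟩
      by_contra hnot
      let e : G.Dart := ⟨(u, v), huv⟩
      have heS : e ∉ S := fun he => hnot ⟨e, he, rfl⟩
      have heS' : e.symm ∉ S := fun he => hnot ⟨e.symm, he, Dart.edge_symm e⟩
      have heA : e ∈ A := same d hd e heS hdu.symm
      refine hcon e heA e.symm ⟨heS', fun he => hv ⟨e.symm, he, rfl⟩⟩ (Or.inr rfl)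
    · rintro ⟨u, v⟩ ⟨hu, hv, -⟩ ⟨u', v'⟩ ⟨hu', hv', -⟩ heq
      rcases Sym2.eq_iff.1 heq with ⟨rfl, rfl⟩ | ⟨rfl, rfl⟩
      · rfl
      · exact absurd hu hv'
  omega

theorem IsKConnected.triangleReplacement [Finite V] {G : SimpleGraph V}
    (h : G.IsKConnected 3) (hc : G.IsCubic) : G.triangleReplacement.IsKConnected 3 := by
  refine ⟨by rw [hc.card_dart]; have := h.1; omega, fun T hT => ?_⟩
  refine induce_compl_triangleReplacement_connected h hc (T : Set G.Dart) ?_ ?_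
  · intro x
    by_contra! hcon
    have : {d : G.Dart | d.fst = x} ⊆ T := fun d hd => by
      by_contra hdT
      exact hcon d hdT hd
    have := Set.ncard_le_ncard this (Set.toFinite _)
    rw [hc.ncard_dart_fst, Set.ncard_coe_finset] at this
    omega
  · refine (Set.ncard_image_le (Set.toFinite _)).trans ?_
    rw [Set.ncard_coe_finset]
    omega

theorem IsKConnected.triangleReplacement_not_iso [Finite V] {G : SimpleGraph V}
    (h : G.IsKConnected 3) (hc : G.IsCubic) :
    ¬ Nonempty (G.triangleReplacement ≃g (⊤ : SimpleGraph (Fin 4))) := by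
  rintro ⟨e⟩
  have h1 := Nat.card_congr e.toEquiv
  have h2 := h.1
  rw [hc.card_dart, Nat.card_fin] at h1
  omega

/-- The darts d, d.symm and z lie on at most two edges, since the first two share one. They cover no
triangle, since d and d.symm are in different triangles. So they do not separate. -/
theorem isKContractible_triangleReplacement_symm [Finite V] {G : SimpleGraph V}
    (h : G.IsKConnected 3) (hc : G.IsCubic) (d : G.Dart) :
    G.triangleReplacement.IsKContractible 3 s(d, d.symm) := by
  refine isKContractible_three_of_forall (h.triangleReplacement hc)
    (by rw [hc.card_dart]; have := h.1; omega) (Or.inr rfl) fun z hz1 hz2 => ?_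
  have hset : {w | w ≠ d ∧ w ≠ d.symm ∧ w ≠ z} = ({d, d.symm, z} : Set G.Dart)ᶜ := by
    ext w
    simp
  rw [hset]
  refine induce_compl_triangleReplacement_connected h hc _ ?_ ?_
  · intro x
    by_contra! hcon
    have hsub : {d : G.Dart | d.fst = x} ⊆ {d, d.symm, z} := fun e he => by
      by_contra heT
      exact hcon e heT he
    have heq := Set.eq_of_subset_of_ncard_le hsub (by
      rw [hc.ncard_dart_fst]
      refine (Set.ncard_insert_le _ _).trans ?_
      have := Set.ncard_insert_le d.symm {z}
      rw [Set.ncard_singleton] at this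
      omega) (Set.toFinite _)
    have h1 : d ∈ {d : G.Dart | d.fst = x} := by
      rw [heq]
      simp
    have h2 : d.symm ∈ {d : G.Dart | d.fst = x} := by
      rw [heq]
      simp
    exact d.fst_symm_ne (h2.trans h1.symm)
  · have : Dart.edge '' ({d, d.symm, z} : Set G.Dart) = {d.edge, z.edge} := by
      simp [Set.image_insert_eq]
    rw [this]
    exact (Set.ncard_insert_le _ _).trans (by simp)

/-- The third dart c of the triangle has neighbours d, e and c.symm only, and among at least twelve
darts there is a further one to be separated from it. -/
theorem not_isKContractible_triangleReplacement [Finite V] {G : SimpleGraph V}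
    (h : G.IsKConnected 3) (hc : G.IsCubic) {d e : G.Dart} (hne : d ≠ e) (hfst : d.fst = e.fst) :
    ¬ G.triangleReplacement.IsKContractible 3 s(d, e) := by
  obtain ⟨c, hcf, hcd, hce, hfib⟩ := hc.exists_third_dart hne hfst
  obtain ⟨t, ht⟩ : ∃ t, t ∉ ({d, e, c, c.symm} : Set G.Dart) := by
    by_contra! hcon
    rw [← Set.eq_univ_iff_forall] at hcon
    have h1 := Set.ncard_univ G.Dart
    rw [← hcon, hc.card_dart] at h1
    have h2 := Set.ncard_insert_le d {e, c, c.symm}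
    have h3 := Set.ncard_insert_le e {c, c.symm}
    have h4 := Set.ncard_insert_le c {c.symm}
    rw [Set.ncard_singleton] at h4
    have := h.1
    omega
  simp only [Set.mem_insert_iff, Set.mem_singleton_iff, not_or] at ht
  refine not_isKContractible_three_of_neighborSet_subset (w := c) (z := c.symm) ?_ hcd hce
    (Dart.symm_ne c).symm ht.1 ht.2.1 ht.2.2.2 ht.2.2.1
  rintro a (⟨h1, h2⟩ | rfl)
  · rcases hfib a (h2.symm.trans hcf) with rfl | rfl | rfl
    · simp
    · simp
    · exact absurd rfl h1
  · simp

/-! ### Lifts of spanning trees -/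

theorem exists_isTriangleLift {G : SimpleGraph V} (hc : G.IsCubic) {T : SimpleGraph V} :
    ∃ T' : SimpleGraph G.Dart, G.IsTriangleLift T T' := by
  have hm : ∀ x : V, ∃ d : G.Dart, d.fst = x := fun x => by
    have : 0 < {d : G.Dart | d.fst = x}.ncard := by
      rw [hc.ncard_dart_fst]
      norm_num
    exact Set.nonempty_of_ncard_ne_zero this.ne'
  choose m hm using hm
  -- m x serves as the middle vertex of the spanning path in the triangle at x.
  refine ⟨{ Adj := fun d d' => (d' = d.symm ∧ T.Adj d.fst d.snd) ∨
              (d ≠ d' ∧ d.fst = d'.fst ∧ (d = m d.fst ∨ d' = m d.fst))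
            symm := ⟨?_⟩
            loopless := ⟨?_⟩ }, ?_, ?_, ?_⟩
  · rintro d d' (⟨rfl, h⟩ | ⟨h1, h2, h3⟩)
    · exact Or.inl ⟨(Dart.symm_symm d).symm, h.symm⟩
    · exact Or.inr ⟨h1.symm, h2.symm, by rw [← h2]; exact h3.symm⟩
  · rintro d (⟨h, -⟩ | ⟨h, -⟩)
    · exact d.symm_ne h.symm
    · exact h rfl
  · rintro d d' (⟨rfl, h⟩ | ⟨h1, h2, h3⟩)
    · exact Or.inr rfl
    · exact Or.inl ⟨h1, h2⟩
  · intro d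
    constructor
    · rintro (⟨-, h⟩ | ⟨-, h2, -⟩)
      · exact h
      · exact absurd h2.symm d.fst_symm_ne
    · exact fun h => Or.inl ⟨rfl, h⟩
  · intro x
    have h2 : ({d : G.Dart | d.fst = x} \ {m x}).ncard = 2 := by
      rw [Set.ncard_sdiff_singleton_of_mem
        (show m x ∈ {d : G.Dart | d.fst = x} from hm x), hc.ncard_dart_fst]
    obtain ⟨a, c, hac, hset⟩ := Set.ncard_eq_two.1 h2
    have ha : a ∈ {d : G.Dart | d.fst = x} \ {m x} := by
      rw [hset]
      simp
    have hc' : c ∈ {d : G.Dart | d.fst = x} \ {m x} := by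
      rw [hset]
      simp
    obtain ⟨rfl, ham⟩ := ha
    obtain ⟨hca, hcm⟩ := hc'
    rw [Set.mem_ofPred_eq] at hca
    rw [Set.mem_singleton_iff] at ham hcm
    refine ⟨a, m a.fst, c, hac, ?_, Or.inr ⟨ham, (hm _).symm, Or.inr rfl⟩,
      Or.inr ⟨Ne.symm hcm, (hm _).trans hca.symm, Or.inl (by rw [hm])⟩, ?_⟩
    · rw [Set.insert_comm, ← hset, Set.insert_sdiff_singleton,
        Set.insert_eq_of_mem
        (show m a.fst ∈ {d : G.Dart | d.fst = a.fst} from hm a.fst)]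
    · rintro (⟨h, -⟩ | ⟨-, -, h | h⟩)
      · rw [h] at hca
        exact a.fst_symm_ne hca
      · exact ham h
      · exact hcm h

theorem IsTriangleLift.contractible_iff [Finite V] {G : SimpleGraph V}
    (h : G.IsKConnected 3) (hc : G.IsCubic) {T : SimpleGraph V} {T' : SimpleGraph G.Dart}
    (hl : G.IsTriangleLift T T') (e : Sym2 G.Dart) :
    (e ∈ T'.edgeSet ∧ G.triangleReplacement.IsKContractible 3 e) ↔
      ∃ d : G.Dart, T.Adj d.fst d.snd ∧ e = s(d, d.symm) := by
  constructor
  · rintro ⟨he, hcon⟩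
    induction e using Sym2.ind with
    | _ a b =>
      have hG := hl.1 he
      change (a ≠ b ∧ a.fst = b.fst) ∨ b = a.symm at hG
      rcases hG with ⟨h1, h2⟩ | rfl
      · exact absurd hcon (not_isKContractible_triangleReplacement h hc h1 h2)
      · exact ⟨a, (hl.2.1 a).1 he, rfl⟩
  · rintro ⟨d, hd, rfl⟩
    exact ⟨(hl.2.1 d).2 hd, isKContractible_triangleReplacement_symm h hc d⟩

/-- The contractible edges of a lift are the pairs {d, d.symm} over edges of T; projecting darts to
their first vertices gives back those edges bijectively. -/
theorem IsTriangleLift.numContractible_eq [Finite V] {G : SimpleGraph V}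
    (h : G.IsKConnected 3) (hc : G.IsCubic) {T : SimpleGraph V} {T' : SimpleGraph G.Dart}
    (hT : T ≤ G) (hl : G.IsTriangleLift T T') :
    G.triangleReplacement.numContractible T' 3 = T.edgeSet.ncard := by
  have hset : {e | e ∈ T'.edgeSet ∧ G.triangleReplacement.IsKContractible 3 e} =
      {e | ∃ d : G.Dart, T.Adj d.fst d.snd ∧ e = s(d, d.symm)} := by
    ext e
    exact hl.contractible_iff h hc e
  rw [numContractible, hset]
  refine Set.ncard_congr (fun e _ => e.map fun d => d.fst) ?_ ?_ ?_
  · rintro _ ⟨d, hd, rfl⟩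
    exact hd
  · rintro _ _ ⟨d, hd, rfl⟩ ⟨e, he, rfl⟩ heq
    rcases (dart_edge_eq_iff d e).1 heq with rfl | rfl
    · rfl
    · rw [Dart.symm_symm, Sym2.eq_swap]
  · intro e he
    induction e using Sym2.ind with
    | _ a b => 
      let d : G.Dart := ⟨(a, b), hT he⟩
      exact ⟨s(d, d.symm), ⟨d, he, rfl⟩, rfl⟩

/-- A side of a cut without crossing edges contains each triangle wholly or not at all, because of
the spanning paths, so it would induce a cut of T without crossing edges. -/
theorem IsTriangleLift.connected {G : SimpleGraph V} {T : SimpleGraph V}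
    {T' : SimpleGraph G.Dart} (hTG : T ≤ G) (hT : T.Connected) (hl : G.IsTriangleLift T T') :
    T'.Connected := by
  rw [connected_iff_forall_cut] at hT ⊢
  constructor
  · obtain ⟨x⟩ := hT.1
    obtain ⟨d, -⟩ := hl.2.2 x
    exact ⟨d⟩
  rintro A ⟨a, ha⟩ ⟨b, hb⟩
  by_contra! hcon
  have same : ∀ d ∈ A, ∀ e : G.Dart, e.fst = d.fst → e ∈ A := by
    intro d hd e he
    obtain ⟨d₁, d₂, d₃, -, hset, h12, h23, -⟩ := hl.2.2 d.fst
    have hd' : d ∈ ({d₁, d₂, d₃} : Set G.Dart) := hset ▸ rfl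
    have he' : e ∈ ({d₁, d₂, d₃} : Set G.Dart) := hset ▸ he
    have step : ∀ {u v}, T'.Adj u v → u ∈ A → v ∈ A := fun huv hu => by
      by_contra hv
      exact hcon _ hu _ hv huv
    have h2 : d₂ ∈ A := by
      rcases hd' with rfl | rfl | rfl
      · exact step h12 hd
      · exact hd
      · exact step h23.symm hd
    rcases he' with rfl | rfl | rfl
    · exact step h12.symm h2
    · exact h2
    · exact step h23 h2
  obtain ⟨u, ⟨d, hd, rfl⟩, v, hv, huv⟩ := hT.2 {x | ∃ d ∈ A, d.fst = x} ⟨_, a, ha, rfl⟩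
    ⟨b.fst, fun ⟨d, hd, hdb⟩ => hb (same d hd b hdb.symm)⟩
  let e : G.Dart := ⟨(d.fst, v), hTG huv⟩
  refine hcon e (same d hd e rfl) e.symm (fun he => hv ⟨_, he, rfl⟩) ((hl.2.1 e).2 huv)

/-- Given connectedness, it suffices to count: |V| - 1 edges from T and at most two in each triangle
make at most 3|V| - 1 edges on 3|V| vertices. -/
theorem IsTriangleLift.isSpanningTree [Finite V] {G : SimpleGraph V} (h : G.IsKConnected 3)
    (hc : G.IsCubic) {T : SimpleGraph V} {T' : SimpleGraph G.Dart}
    (hT : G.IsSpanningTree T) (hl : G.IsTriangleLift T T') :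
    G.triangleReplacement.IsSpanningTree T' := by
  have hconn := hl.connected hT.1 hT.2.connected
  refine ⟨hl.1, isTree_iff_connected_and_card.2 ⟨hconn, ?_⟩⟩
  have h1 := (isTree_iff_connected_and_card.1 hT.2).2
  have h2 := hconn.card_vert_le_card_edgeSet_add_one
  have h3 := hl.numContractible_eq h hc hT.1
  have h4 := hl.2.2
  choose d₁ d₂ d₃ hd₁₃ hset h12 h23 h13 using h4
  have htri : {e | e ∈ T'.edgeSet ∧ ¬ G.triangleReplacement.IsKContractible 3 e} ⊆
      Set.range (fun x => s(d₁ x, d₂ x)) ∪ Set.range (fun x => s(d₂ x, d₃ x)) := by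
    rintro e ⟨he, hne⟩
    induction e using Sym2.ind with
    | _ a b =>
      have hG := hl.1 he
      change (a ≠ b ∧ a.fst = b.fst) ∨ b = a.symm at hG
      rcases hG with ⟨hab, hfst⟩ | rfl
      · have ha : a ∈ ({d₁ a.fst, d₂ a.fst, d₃ a.fst} : Set G.Dart) := by
          rw [← hset]
          rfl
        have hb : b ∈ ({d₁ a.fst, d₂ a.fst, d₃ a.fst} : Set G.Dart) := by
          rw [← hset]
          exact hfst.symm
        generalize a.fst = x at *
        rw [mem_edgeSet] at he
        have hn := h13 x
        rcases ha with rfl | rfl | rfl <;> rcases hb with rfl | rfl | rfl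
        · exact absurd rfl hab
        · exact Or.inl ⟨x, rfl⟩
        · exact absurd he hn
        · exact Or.inl ⟨x, Sym2.eq_swap⟩
        · exact absurd rfl hab
        · exact Or.inr ⟨x, rfl⟩
        · exact absurd he.symm hn
        · exact Or.inr ⟨x, Sym2.eq_swap⟩
        · exact absurd rfl hab
      · exact absurd (isKContractible_triangleReplacement_symm h hc a) hne
  have hle : T'.edgeSet.ncard ≤ G.triangleReplacement.numContractible T' 3 +
      (Nat.card V + Nat.card V) := by
    have hsub : T'.edgeSet ⊆
        {e | e ∈ T'.edgeSet ∧ G.triangleReplacement.IsKContractible 3 e} ∪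
        (Set.range (fun x => s(d₁ x, d₂ x)) ∪ Set.range (fun x => s(d₂ x, d₃ x))) := by
      intro e he
      by_cases hk : G.triangleReplacement.IsKContractible 3 e
      · exact Or.inl ⟨he, hk⟩
      · exact Or.inr (htri ⟨he, hk⟩)
    refine (Set.ncard_le_ncard hsub (Set.toFinite _)).trans
      ((Set.ncard_union_le _ _).trans (Nat.add_le_add_left
        ((Set.ncard_union_le _ _).trans (Nat.add_le_add ?_ ?_)) _)) <;>
    · rw [← Set.image_univ, ← Set.ncard_univ]
      exact Set.ncard_image_le (Set.toFinite _)
  rw [Nat.card_coe_set_eq] at h1 h2 ⊢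
  rw [hc.card_dart] at h2 ⊢
  omega

theorem IsTriangleLift.cast_numContractible_eq [Finite V] {G : SimpleGraph V}
    (h : G.IsKConnected 3) (hc : G.IsCubic) {T : SimpleGraph V} {T' : SimpleGraph G.Dart}
    (hT : G.IsSpanningTree T) (hl : G.IsTriangleLift T T') :
    (G.triangleReplacement.numContractible T' 3 : ℝ) = (Nat.card G.Dart : ℝ) / 3 - 1 := by
  have h1 := (isTree_iff_connected_and_card.1 hT.2).2
  rw [Nat.card_coe_set_eq] at h1
  rw [hl.numContractible_eq h hc hT.1, hc.card_dart, ← h1]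
  push_cast
  ring

/-! ### Hamiltonian paths as DFS trees, and their lifts -/

theorem Walk.adj_spanningCoe_toSubgraph {G : SimpleGraph V} {a b u v : V} (p : G.Walk a b) :
    p.toSubgraph.spanningCoe.Adj u v ↔ s(u, v) ∈ p.edges := by
  rw [Subgraph.spanningCoe_adj, Walk.adj_toSubgraph_iff_mem_edges]

theorem Walk.IsHamiltonian.isSpanningTree [Finite V] [DecidableEq V] {G : SimpleGraph V} {a b : V}
    {p : G.Walk a b} (hp : p.IsHamiltonian) : G.IsSpanningTree p.toSubgraph.spanningCoe := by
  have : Fintype V := Fintype.ofFinite V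
  have hmem : ∀ e ∈ p.edges, e ∈ p.toSubgraph.spanningCoe.edgeSet := by
    intro e he
    induction e using Sym2.ind with
    | _ u v => exact p.adj_spanningCoe_toSubgraph.2 he
  have hconn : p.toSubgraph.spanningCoe.Connected := by
    have hreach : ∀ v, p.toSubgraph.spanningCoe.Reachable a v := fun v =>
      ⟨(p.takeUntil v (hp.mem_support v)).transfer _ fun e he =>
        hmem e (p.edges_takeUntil_subset_edges _ he)⟩
    exact (connected_iff _).2 ⟨fun u v => (hreach u).symm.trans (hreach v), ⟨a⟩⟩
  refine ⟨Subgraph.spanningCoe_le _, isTree_iff_connected_and_card.2 ⟨hconn, ?_⟩⟩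
  have h1 := hconn.card_vert_le_card_edgeSet_add_one
  have h2 := hp.length_eq
  have h3 : p.toSubgraph.spanningCoe.edgeSet.ncard ≤ p.edges.length := by
    have : p.toSubgraph.spanningCoe.edgeSet ⊆ (p.edges.toFinset : Set (Sym2 V)) := by
      intro e he
      induction e using Sym2.ind with
      | _ u v => simpa using p.adj_spanningCoe_toSubgraph.1 he
    refine (Set.ncard_le_ncard this (Set.toFinite _)).trans ?_
    rw [Set.ncard_coe_finset]
    exact List.toFinset_card_le _
  have h4 : 0 < Fintype.card V := Fintype.card_pos_iff.2 ⟨a⟩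
  rw [Walk.length_edges] at h3
  rw [Nat.card_coe_set_eq, Nat.card_eq_fintype_card] at h1 ⊢
  omega

theorem IsBranch.mem_of_adj {Q : SimpleGraph V} {r x u v : V} {B : Set V}
    (hB : Q.IsBranch r x B) (hu : u ∈ B) (huv : Q.Adj u v) (hv : v ≠ x) : v ∈ B := by
  obtain ⟨⟨C, rfl⟩, -⟩ := hB
  obtain ⟨u, hu, rfl⟩ := hu
  exact ⟨⟨v, hv⟩, C.mem_supp_of_adj_mem_supp hu huv, rfl⟩

theorem IsBranch.eq_of_mem {Q : SimpleGraph V} {r x u : V} {B B' : Set V}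
    (hB : Q.IsBranch r x B) (hB' : Q.IsBranch r x B') (hu : u ∈ B) (hu' : u ∈ B') : B = B' := by
  obtain ⟨⟨C, rfl⟩, -⟩ := hB
  obtain ⟨⟨C', rfl⟩, -⟩ := hB'
  obtain ⟨u, hu, rfl⟩ := hu
  obtain ⟨w, hw, hwu⟩ := hu'
  obtain rfl := Subtype.ext hwu
  rw [ConnectedComponent.mem_supp_iff] at hu hw
  rw [← hu, ← hw]

/-- A Hamiltonian path rooted at its first vertex is a DFS tree. -/
theorem Walk.IsHamiltonian.isDFSTree [Finite V] [DecidableEq V] {G : SimpleGraph V} {a b : V}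
    {p : G.Walk a b} (hp : p.IsHamiltonian) : G.IsDFSTree p.toSubgraph.spanningCoe a := by
  refine ⟨hp.isSpanningTree, fun x B B' hB hB' hne => absurd ?_ hne⟩
  obtain ⟨k, hk, hkl⟩ := Walk.mem_support_iff_exists_getVert.1 (hp.mem_support x)
  have inj : ∀ i j, i ≤ p.length → j ≤ p.length → p.getVert i = p.getVert j → i = j :=
    fun i j hi hj h => hp.isPath.getVert_injOn hi hj h
  -- Every branch at the k-th vertex contains its successor on the path, so two branches coincide.
  -- From a member beyond k one walks back to index k + 1; from a member before k one would walk
  -- back to the root. At the last vertex there are no branches, and the claim is vacuous.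
  have key : ∀ B, p.toSubgraph.spanningCoe.IsBranch a x B → p.getVert (k + 1) ∈ B := by
    intro B hB
    have down : ∀ n i, n ≤ i → i ≤ p.length → (∀ j, n ≤ j → j ≤ i → j ≠ k) → p.getVert i ∈ B →
        p.getVert n ∈ B := by
      intro n i hni
      induction i, hni using Nat.le_induction with
      | base => exact fun _ _ h => h
      | succ i hi ih =>
        intro hil hjk hmem
        refine ih (by omega) (fun j h1 h2 => hjk j h1 (by omega)) (hB.mem_of_adj hmem ?_ ?_)
        · exact (p.toSubgraph_adj_getVert (by omega)).symm
        · intro hx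
          exact hjk i hi (by omega) (inj _ _ (by omega) hkl (hx.trans hk.symm))
    obtain ⟨u, hu⟩ : B.Nonempty := by
      obtain ⟨⟨C, rfl⟩, -⟩ := hB
      exact C.nonempty_supp.image _
    have hux : u ≠ x := by
      obtain ⟨⟨C, rfl⟩, -⟩ := hB
      obtain ⟨u, -, rfl⟩ := hu
      exact u.2
    obtain ⟨i, rfl, hil⟩ := Walk.mem_support_iff_exists_getVert.1 (hp.mem_support u)
    rcases lt_trichotomy i k with h | h | h
    · refine absurd (down 0 i (by omega) hil (fun j _ h2 => by omega) hu) ?_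
      rw [Walk.getVert_zero]
      exact hB.2
    · exact absurd (h ▸ hk) hux
    · exact down (k + 1) i h hil (fun j h1 _ => by omega) hu
  exact hB.eq_of_mem hB' (key B hB) (key B' hB')

theorem Dart.mk_symm_ne_of_fst_eq {G : SimpleGraph V} {a b : G.Dart} (h : a.fst = b.fst)
    (f : G.Dart) : s(f, f.symm) ≠ s(a, b) := by
  intro heq
  rcases Sym2.eq_iff.1 heq with ⟨rfl, rfl⟩ | ⟨rfl, rfl⟩
  · exact f.fst_symm_ne h.symm
  · exact f.fst_symm_ne h

/-- A path of a cubic graph lifts to a path of the triangle replacement that runs through all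
triangles along the path, starting at a prescribed dart that is not on the path. -/
theorem exists_triangleReplacement_walk {G : SimpleGraph V} (hc : G.IsCubic) {u b : V}
    (q : G.Walk u b) (hq : q.IsPath) (d : G.Dart) (hd : d.fst = u) (hde : d.edge ∉ q.edges) :
    ∃ (b' : G.Dart) (q' : G.triangleReplacement.Walk d b'), q'.IsPath ∧
      (∀ e, e ∈ q'.support ↔ e.fst ∈ q.support) ∧
      (∀ e : G.Dart, s(e, e.symm) ∈ q'.edges ↔ e.edge ∈ q.edges) ∧
      ∀ x ∈ q.support, ∃ d₁ d₂ d₃ : G.Dart, d₁ ≠ d₃ ∧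
        {d : G.Dart | d.fst = x} = {d₁, d₂, d₃} ∧
        s(d₁, d₂) ∈ q'.edges ∧ s(d₂, d₃) ∈ q'.edges ∧ s(d₁, d₃) ∉ q'.edges := by
  induction q generalizing d with
  | nil =>
    subst hd
    obtain ⟨e, hed, hne⟩ : ∃ e : G.Dart, e.fst = d.fst ∧ e ≠ d :=
      Set.exists_ne_of_one_lt_ncard (s := {e : G.Dart | e.fst = d.fst})
        (by rw [hc.ncard_dart_fst]; norm_num) d
    obtain ⟨t, htd, h1, h2, hfib⟩ := hc.exists_third_dart hne.symm hed.symm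
    have a1 : G.triangleReplacement.Adj d e := Or.inl ⟨hne.symm, hed.symm⟩
    have a2 : G.triangleReplacement.Adj e t := Or.inl ⟨h2.symm, hed.trans htd.symm⟩
    refine ⟨t, .cons a1 (.cons a2 .nil), ?_, ?_, ?_, ?_⟩
    · simp [Walk.cons_isPath_iff, h1.symm, hne.symm, h2.symm]
    · intro f
      simp only [Walk.support_cons, Walk.support_nil, List.mem_cons, List.not_mem_nil, or_false]
      constructor
      · rintro (rfl | rfl | rfl) <;> first | rfl | assumption
      · exact hfib f
    · intro f
      simp [-Sym2.eq, Dart.mk_symm_ne_of_fst_eq hed.symm,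
        Dart.mk_symm_ne_of_fst_eq (hed.trans htd.symm)]
    · intro x hx
      simp only [Walk.support_nil, List.mem_singleton] at hx
      subst hx
      refine ⟨d, e, t, h1.symm, ?_, ?_, ?_, ?_⟩
      · ext f
        simp only [Set.mem_ofPred_eq, Set.mem_insert_iff, Set.mem_singleton_iff]
        constructor
        · exact hfib f
        · rintro (rfl | rfl | rfl) <;> first | rfl | assumption
      · simp
      · simp
      · simp [h1, h2, h1.symm, hne.symm]
  | @cons u v b h q ih =>
    subst hd
    rw [Walk.cons_isPath_iff] at hq
    -- The lifted path enters the triangle at d, passes the third dart t, leaves at e and crosses to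
    -- e.symm. The hypothesis that d is not on the path ensures d ≠ e; it is inherited by e.symm
    -- since the path does not return to its first vertex.
    let e : G.Dart := ⟨(d.fst, v), h⟩
    have hne : d ≠ e := by
      rintro hcon
      apply hde
      rw [Walk.edges_cons, List.mem_cons]
      exact Or.inl (congrArg Dart.edge hcon)
    obtain ⟨t, htd, h1, h2, hfib⟩ := hc.exists_third_dart hne rfl
    have hte : t.fst = e.fst := htd
    obtain ⟨b', q', hq', hsupp, hedges, htri⟩ := ih hq.1 e.symm rfl (fun hmem =>
      hq.2 (q.fst_mem_support_of_mem_edges (by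
        rw [Dart.edge_symm] at hmem
        exact hmem)))
    have a1 : G.triangleReplacement.Adj d t := Or.inl ⟨h1.symm, htd.symm⟩
    have a2 : G.triangleReplacement.Adj t e := Or.inl ⟨h2, htd⟩
    have a3 : G.triangleReplacement.Adj e e.symm := Or.inr rfl
    have notin : ∀ f : G.Dart, f.fst = d.fst → f ∉ q'.support := fun f hf hmem =>
      hq.2 (hf ▸ (hsupp f).1 hmem)
    refine ⟨b', .cons a1 (.cons a2 (.cons a3 q')), ?_, ?_, ?_, ?_⟩
    · simp [Walk.cons_isPath_iff, hq', h1.symm, h2, hne, notin d rfl, notin t htd, notin e rfl]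
    · intro f
      simp only [Walk.support_cons, List.mem_cons, hsupp]
      constructor
      · rintro (rfl | rfl | rfl | hf)
        · exact Or.inl rfl
        · exact Or.inl htd
        · exact Or.inl rfl
        · exact Or.inr hf
      · rintro (hf | hf)
        · rcases hfib f hf with h | h | h <;> tauto
        · tauto
    · intro f
      simp only [Walk.edges_cons, List.mem_cons, hedges, Dart.mk_symm_ne_of_fst_eq htd.symm,
        Dart.mk_symm_ne_of_fst_eq hte, false_or]
      have : s(f, f.symm) = s(e, e.symm) ↔ f.edge = s(d.fst, v) := by
        rw [show s(d.fst, v) = e.edge from rfl, dart_edge_eq_iff, Sym2.eq_iff]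
        constructor
        · rintro (⟨h, -⟩ | ⟨h, -⟩)
          · exact Or.inl h
          · exact Or.inr h
        · rintro (h | h)
          · exact Or.inl ⟨h, by rw [h]⟩
          · exact Or.inr ⟨h, by rw [h, Dart.symm_symm]⟩
      rw [this]
    · intro x hx
      rw [Walk.support_cons, List.mem_cons] at hx
      rcases hx with rfl | hx
      · refine ⟨d, t, e, hne, ?_, ?_, ?_, ?_⟩
        · ext f
          simp only [Set.mem_ofPred_eq, Set.mem_insert_iff, Set.mem_singleton_iff]
          constructor
          · intro hf
            rcases hfib f hf with h | h | h <;> tauto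
          · rintro (rfl | rfl | rfl) <;> first | rfl | assumption
        · simp
        · simp
        · simp only [Walk.edges_cons, List.mem_cons, not_or]
          refine ⟨?_, ?_, (Dart.mk_symm_ne_of_fst_eq (a := d) (b := e) rfl e).symm,
            fun hmem => notin d rfl (q'.fst_mem_support_of_mem_edges hmem)⟩
          · rw [Sym2.eq_iff]
            rintro (⟨-, h⟩ | ⟨h, -⟩)
            · exact h2 h.symm
            · exact h1 h.symm
          · rw [Sym2.eq_iff]
            rintro (⟨h, -⟩ | ⟨h, -⟩)
            · exact h1 h.symm
            · exact hne h
      · obtain ⟨d₁, d₂, d₃, h13, hset, e12, e23, e13⟩ := htri x hx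
        have hd1 : d₁.fst = x := by
          have : d₁ ∈ {d : G.Dart | d.fst = x} := by
            rw [hset]
            simp
          exact this
        have hd3 : d₃.fst = x := by
          have : d₃ ∈ {d : G.Dart | d.fst = x} := by
            rw [hset]
            simp
          exact this
        have hxu : ∀ f : G.Dart, f.fst = x → f.fst ≠ d.fst := fun f hf hfd =>
          hq.2 (by rw [← hfd, hf]; exact hx)
        refine ⟨d₁, d₂, d₃, h13, hset, ?_, ?_, ?_⟩
        · simp only [Walk.edges_cons, List.mem_cons]
          tauto
        · simp only [Walk.edges_cons, List.mem_cons]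
          tauto
        · simp only [Walk.edges_cons, List.mem_cons, not_or]
          refine ⟨?_, ?_, (Dart.mk_symm_ne_of_fst_eq (hd1.trans hd3.symm) e).symm, e13⟩
          · rw [Sym2.eq_iff]
            rintro (⟨h, -⟩ | ⟨-, h⟩)
            · exact hxu _ hd1 (h ▸ rfl)
            · exact hxu _ hd3 (h ▸ rfl)
          · rw [Sym2.eq_iff]
            rintro (⟨-, h⟩ | ⟨h, -⟩)
            · exact hxu _ hd3 (h ▸ rfl)
            · exact hxu _ hd1 (h ▸ rfl)

theorem exists_isHamiltonian_isTriangleLift [DecidableEq V] {G : SimpleGraph V}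
    (hc : G.IsCubic) {a b : V} {p : G.Walk a b} (hp : p.IsHamiltonian) :
    ∃ (a' b' : G.Dart) (p' : G.triangleReplacement.Walk a' b'), p'.IsHamiltonian ∧
      G.IsTriangleLift p.toSubgraph.spanningCoe p'.toSubgraph.spanningCoe := by
  -- Of the three darts at the end a, only that of the first edge, if there is one, lies on the
  -- path; any other can start the lift.
  obtain ⟨d, hd, hde⟩ : ∃ d : G.Dart, d.fst = a ∧ d.edge ∉ p.edges := by
    cases p with
    | nil =>
      obtain ⟨d, hd⟩ : {d : G.Dart | d.fst = a}.Nonempty :=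
        Set.nonempty_of_ncard_ne_zero (by rw [hc.ncard_dart_fst]; norm_num)
      exact ⟨d, hd, by simp⟩
    | @cons _ v _ h q =>
      have hpath := hp.isPath
      rw [Walk.cons_isPath_iff] at hpath
      obtain ⟨d, hd, hne⟩ := Set.exists_ne_of_one_lt_ncard (s := {e : G.Dart | e.fst = a})
        (by rw [hc.ncard_dart_fst]; norm_num) ⟨(a, v), h⟩
      refine ⟨d, hd, ?_⟩
      rw [Set.mem_ofPred_eq] at hd
      subst hd
      rw [Walk.edges_cons, List.mem_cons, not_or]
      refine ⟨fun heq => ?_, fun hmem => hpath.2 (q.fst_mem_support_of_mem_edges hmem)⟩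
      rcases (dart_edge_eq_iff d ⟨(d.fst, v), h⟩).1 heq with h' | h'
      · exact hne h'
      · have : d.fst = v := congrArg (fun e : G.Dart => e.fst) h'
        exact h.ne this
  obtain ⟨b', p', hp', hsupp, hedges, htri⟩ :=
    exists_triangleReplacement_walk hc p hp.isPath d hd hde
  refine ⟨d, b', p', hp'.isHamiltonian_of_mem fun e => (hsupp e).2 (hp.mem_support _),
    Subgraph.spanningCoe_le _, fun e => ?_, fun x => ?_⟩
  · rw [Walk.adj_spanningCoe_toSubgraph, Walk.adj_spanningCoe_toSubgraph, hedges]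
    rfl
  · simp only [Walk.adj_spanningCoe_toSubgraph]
    exact htri x (hp.mem_support x)

/-! ### Invariance under isomorphism -/

theorem Iso.isKConnected {G : SimpleGraph V} {H : SimpleGraph W} (φ : G ≃g H) {k : ℕ}
    (h : G.IsKConnected k) : H.IsKConnected k := by
  refine ⟨(Nat.card_congr φ.toEquiv) ▸ h.1, fun T hT => ?_⟩
  have h1 := h.2 (T.map φ.symm.toEquiv.toEmbedding) (by rwa [Finset.card_map])
  have hmem : ∀ v, v ∉ T.map φ.symm.toEquiv.toEmbedding ↔ φ v ∉ T := by
    intro v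
    rw [not_iff_not, Finset.mem_map]
    constructor
    · rintro ⟨w, hw, rfl⟩
      simpa using hw
    · intro hv
      exact ⟨φ v, hv, by simp⟩
  refine h1.of_surjective_collapse (fun v => ⟨φ v.1, (hmem _).1 v.2⟩) ?_ ?_
  · rintro ⟨w, hw⟩
    refine ⟨⟨φ.symm w, (hmem _).2 (by simpa using hw)⟩, ?_⟩
    simp
  · rintro ⟨v, hv⟩ ⟨w, hw⟩ hvw
    exact Or.inr (φ.map_adj_iff.2 hvw)

theorem Iso.isCubic {G : SimpleGraph V} {H : SimpleGraph W} (φ : G ≃g H)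
    (h : G.IsCubic) : H.IsCubic := by
  intro w
  have := Nat.card_congr (φ.mapNeighborSet (φ.symm w))
  rw [Nat.card_coe_set_eq, Nat.card_coe_set_eq, h, RelIso.apply_symm_apply] at this
  exact this.symm

/-- Isomorphic graphs have isomorphic contractions. -/
def Iso.contractEdge {G : SimpleGraph V} {H : SimpleGraph W} (φ : G ≃g H) (e : Sym2 V) :
    G.contractEdge e ≃g H.contractEdge (e.map φ) where
  toEquiv := Quotient.congr φ.toEquiv fun a b => by
    have hmem : ∀ x, φ x ∈ e.map φ ↔ x ∈ e := fun x => by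
      rw [Sym2.mem_map]
      constructor
      · rintro ⟨y, hy, hyx⟩
        exact φ.injective hyx ▸ hy
      · exact fun hx => ⟨x, hx, rfl⟩
    change (a = b ∨ (a ∈ e ∧ b ∈ e)) ↔ (φ a = φ b ∨ (φ a ∈ e.map φ ∧ φ b ∈ e.map φ))
    rw [hmem, hmem, φ.injective.eq_iff]
  map_rel_iff' := by
    intro a b
    refine and_congr (not_congr (Equiv.apply_eq_iff_eq _)) ⟨?_, ?_⟩
    · rintro ⟨u, v, hu, hv, huv⟩
      refine ⟨φ.symm u, φ.symm v, ?_, ?_, φ.symm.map_adj_iff.2 huv⟩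
      · apply (Equiv.injective (Quotient.congr φ.toEquiv _))
        rw [← hu, Quotient.congr_mk]
        simp
      · apply (Equiv.injective (Quotient.congr φ.toEquiv _))
        rw [← hv, Quotient.congr_mk]
        simp
    · rintro ⟨u, v, rfl, rfl, huv⟩
      exact ⟨φ u, φ v, rfl, rfl, φ.map_adj_iff.2 huv⟩

theorem Iso.isKContractible {G : SimpleGraph V} {H : SimpleGraph W} (φ : G ≃g H) {k : ℕ}
    {e : Sym2 V} (h : G.IsKContractible k e) : H.IsKContractible k (e.map φ) := by
  refine ⟨?_, (φ.contractEdge e).isKConnected h.2⟩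
  have := h.1
  induction e using Sym2.ind with
  | _ a b => exact φ.map_adj_iff.2 this

theorem Iso.isKContractible_iff {G : SimpleGraph V} {H : SimpleGraph W} (φ : G ≃g H) {k : ℕ}
    {e : Sym2 V} : H.IsKContractible k (e.map φ) ↔ G.IsKContractible k e := by
  refine ⟨fun h => ?_, φ.isKContractible⟩
  have := φ.symm.isKContractible h
  rw [Sym2.map_map] at this
  convert this
  induction e using Sym2.ind with
  | _ a b => simp

theorem Iso.numContractible_map {G : SimpleGraph V} {H : SimpleGraph W} (φ : G ≃g H) {k : ℕ}
    {a b : V} (p : G.Walk a b) :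
    H.numContractible (p.map φ.toHom).toSubgraph.spanningCoe k =
      G.numContractible p.toSubgraph.spanningCoe k := by
  have hedge : ∀ {V : Type _} {G : SimpleGraph V} {a b : V} (p : G.Walk a b) (e : Sym2 V),
      e ∈ p.toSubgraph.spanningCoe.edgeSet ↔ e ∈ p.edges := fun p e => by
    induction e using Sym2.ind with
    | _ a b => exact p.adj_spanningCoe_toSubgraph
  have hedge' : ∀ (e : Sym2 W),
      e ∈ (p.map φ.toHom).toSubgraph.spanningCoe.edgeSet ↔ e ∈ (p.map φ.toHom).edges :=
    fun e => by
      induction e using Sym2.ind with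
      | _ a b => exact (p.map φ.toHom).adj_spanningCoe_toSubgraph
  symm
  refine Set.ncard_congr (fun e _ => e.map φ) ?_ ?_ ?_
  · rintro e ⟨h1, h2⟩
    refine ⟨(hedge' _).2 ?_, φ.isKContractible h2⟩
    rw [Walk.edges_map]
    exact List.mem_map_of_mem ((hedge p e).1 h1)
  · exact fun e f _ _ h => Sym2.map.injective φ.injective h
  · rintro e ⟨h1, h2⟩
    have h3 := (hedge' _).1 h1
    rw [Walk.edges_map, List.mem_map] at h3
    obtain ⟨f, hf, rfl⟩ := h3
    exact ⟨f, ⟨(hedge p f).2 hf, φ.isKContractible_iff.1 h2⟩, rfl⟩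

/-! ### Arbitrarily large examples -/

theorem isKConnected_three_top : (⊤ : SimpleGraph (Fin 4)).IsKConnected 3 := by
  refine ⟨by simp, fun T hT => ?_⟩
  rw [induce_connected_iff_forall_cut]
  constructor
  · obtain ⟨x, -, hx⟩ := Finset.exists_mem_notMem_of_card_lt_card
      (s := T) (t := Finset.univ) (by simp; omega)
    exact ⟨x, hx⟩
  · rintro A - ⟨a, ha⟩ ⟨b, hb⟩
    exact ⟨a, ha, b, hb, fun h => hb.2 (h ▸ ha)⟩

theorem isCubic_top : (⊤ : SimpleGraph (Fin 4)).IsCubic := by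
  intro v
  have h : (⊤ : SimpleGraph (Fin 4)).neighborSet v = {v}ᶜ := by
    ext w
    simp [eq_comm]
  rw [h, Set.ncard_compl, Set.ncard_singleton]
  simp

theorem exists_isHamiltonian_top :
    ∃ (a b : Fin 4) (p : (⊤ : SimpleGraph (Fin 4)).Walk a b), p.IsHamiltonian := by
  refine ⟨0, 3, .cons (v := 1) (by simp) (.cons (v := 2) (by simp)
    (.cons (v := 3) (by simp) .nil)), ?_⟩
  intro v
  fin_cases v <;> rfl

/-- Starting from K_4, each triangle replacement triples the order and preserves 3-connectedness,
cubicity and the existence of a Hamiltonian path. -/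
theorem exists_large_cubic_isHamiltonian (N : ℕ) :
    ∃ (V : Type) (_ : Finite V) (_ : DecidableEq V) (G : SimpleGraph V) (a b : V)
      (p : G.Walk a b), N ≤ Nat.card V ∧ G.IsKConnected 3 ∧ G.IsCubic ∧ p.IsHamiltonian := by
  induction N with
  | zero =>
    obtain ⟨a, b, p, hp⟩ := exists_isHamiltonian_top
    exact ⟨Fin 4, inferInstance, inferInstance, ⊤, a, b, p, Nat.zero_le _,
      isKConnected_three_top, isCubic_top, hp⟩
  | succ N ih =>
    obtain ⟨V, _, _, G, a, b, p, hN, h, hc, hp⟩ := ih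
    obtain ⟨a', b', p', hp', -⟩ := exists_isHamiltonian_isTriangleLift hc hp
    refine ⟨G.Dart, inferInstance, inferInstance, G.triangleReplacement, a', b', p', ?_,
      h.triangleReplacement hc, hc.triangleReplacement, hp'⟩
    have := h.1
    rw [hc.card_dart]
    omega

end SimpleGraph

theorem theorem4 :
    -- the lower bound
    (∀ (V : Type*) [Finite V] (G : SimpleGraph V),
      G.IsKConnected 3 → G.IsCubic → ¬ Nonempty (G ≃g (⊤ : SimpleGraph (Fin 4))) →
      ∀ Q : SimpleGraph V, G.IsSpanningTree Q →
        (Nat.card V : ℝ) / 3 - 1 ≤ (G.numContractible Q 3 : ℝ)) ∧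
    -- sharpness for DFS trees (hence for spanning trees), for arbitrarily large graphs
    (∀ N : ℕ, ∃ n ≥ N, ∃ (G : SimpleGraph (Fin n)) (Q : SimpleGraph (Fin n)) (r : Fin n),
      G.IsKConnected 3 ∧ G.IsCubic ∧ ¬ Nonempty (G ≃g (⊤ : SimpleGraph (Fin 4))) ∧
      G.IsDFSTree Q r ∧ (G.numContractible Q 3 : ℝ) = (n : ℝ) / 3 - 1) ∧
    -- the construction that yields sharp examples from every cubic 3-connected graph
    (∀ (V : Type*) [Finite V] [DecidableEq V] (G : SimpleGraph V),
      G.IsKConnected 3 → G.IsCubic →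
      G.triangleReplacement.IsKConnected 3 ∧ G.triangleReplacement.IsCubic ∧
      ¬ Nonempty (G.triangleReplacement ≃g (⊤ : SimpleGraph (Fin 4))) ∧
      -- spanning trees
      (∀ T : SimpleGraph V, G.IsSpanningTree T →
        (∃ T' : SimpleGraph G.Dart, G.IsTriangleLift T T') ∧
        ∀ T' : SimpleGraph G.Dart, G.IsTriangleLift T T' →
          G.triangleReplacement.IsSpanningTree T' ∧
          (G.triangleReplacement.numContractible T' 3 : ℝ) = (Nat.card G.Dart : ℝ) / 3 - 1) ∧
      -- DFS trees, from Hamiltonian paths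
      (∀ (a b : V) (p : G.Walk a b), p.IsHamiltonian →
        ∃ (a' b' : G.Dart) (p' : G.triangleReplacement.Walk a' b'), p'.IsHamiltonian ∧
          G.IsTriangleLift p.toSubgraph.spanningCoe p'.toSubgraph.spanningCoe ∧
          G.triangleReplacement.IsDFSTree p'.toSubgraph.spanningCoe a' ∧
          (G.triangleReplacement.numContractible p'.toSubgraph.spanningCoe 3 : ℝ) =
            (Nat.card G.Dart : ℝ) / 3 - 1)) := by
  refine ⟨?_, ?_, ?_⟩
  · intro V _ G h hc hK Q hQ
    have := SimpleGraph.card_le_numContractible h hc hK hQ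
    have : (Nat.card V : ℝ) ≤ 3 * (G.numContractible Q 3 : ℝ) + 3 := by exact_mod_cast this
    linarith
  · intro N
    obtain ⟨V, _, _, G, a, b, p, hN, h, hc, hp⟩ :=
      SimpleGraph.exists_large_cubic_isHamiltonian N
    obtain ⟨a', b', p', hp', hl⟩ := SimpleGraph.exists_isHamiltonian_isTriangleLift hc hp
    have hcard := hl.cast_numContractible_eq h hc hp.isSpanningTree
    -- The example lives on darts; relabelling moves it to `Fin n` as the statement demands.
    let e : G.Dart ≃ Fin (Nat.card G.Dart) := Finite.equivFin G.Dart
    let φ : G.triangleReplacement ≃g G.triangleReplacement.map e.toEmbedding :=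
      SimpleGraph.Iso.map e _
    refine ⟨Nat.card G.Dart, ?_, G.triangleReplacement.map e.toEmbedding,
      (p'.map φ.toHom).toSubgraph.spanningCoe, φ a',
      φ.isKConnected (h.triangleReplacement hc), φ.isCubic hc.triangleReplacement, ?_,
      (hp'.map φ.toHom φ.bijective).isDFSTree, ?_⟩
    · rw [hc.card_dart]
      omega
    · rintro ⟨ψ⟩
      exact h.triangleReplacement_not_iso hc ⟨φ.trans ψ⟩
    · rw [φ.numContractible_map, hcard]
  · intro V _ _ G h hc
    refine ⟨h.triangleReplacement hc, hc.triangleReplacement, h.triangleReplacement_not_iso hc,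
      fun T hT => ⟨SimpleGraph.exists_isTriangleLift hc, fun T' hl =>
        ⟨hl.isSpanningTree h hc hT, hl.cast_numContractible_eq h hc hT⟩⟩, ?_⟩
    intro a b p hp
    obtain ⟨a', b', p', hp', hl⟩ := SimpleGraph.exists_isHamiltonian_isTriangleLift hc hp
    exact ⟨a', b', p', hp', hl, hp'.isDFSTree, hl.cast_numContractible_eq h hc hp.isSpanningTree⟩
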